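/- Let $d\ge 1$ and let $\Omega$ be an integer-valued symplectic form on $\mathbb{Z}^{2d}$, i.e. an antisymmetric non-degenerate bilinear form $\mathbb{Z}^{2d}\times\mathbb{Z}^{2d}\to\mathbb{Z}$ (not necessarily unimodular). Let $\mathrm{Sp}(\Omega,\mathbb{Z})$ be the group of matrices in $\mathrm{SL}(2d,\mathbb{Z})$ that preserve $\Omega$. A matrix $A\in \mathrm{Sp}(\Omega,\mathbb{Z})$ is called *Galois-pinching* if its characteristic polynomial $P$ is irreducible over $\mathbb{Q}$, all roots of $P$ are real, and its Galois group $\mathrm{Gal}$ is the largest possible: writing $\widetilde R$ for the set of roots of $P$ and $R=\{\lambda+\lambda^{-1}:\lambda\in\widetilde R\}$, every permutation of $R$ is induced by an element of $\mathrm{Gal}$, and for every subset $S\subseteq R$ there is an element of $\mathrm{Gal}$ that sends $\lambda$ to $\lambda^{-1}$ for each $\lambda\in\widetilde R$ with $\lambda+\lambda^{-1}\in S$ and fixes every other root. For $1\le k\le d$, a matrix $C\in \mathrm{Sp}(\Omega,\mathbb{Z})$ is called *$k$-twisting with respect to $A$* if $C(F)\cap F'=\{0\}$ for every $A$-invariant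 isotropic subspace $F\subseteq\mathbb{R}^{2d}$ of dimension $k$ and every $A$-invariant coisotropic subspace $F'\subseteq\mathbb{R}^{2d}$ of dimension $2d-k$. **Theorem.** Let $A,B\in \mathrm{Sp}(\Omega,\mathbb{Z})$. Assume that $A$ is Galois-pinching and that no subspace $F$ of $\mathbb{R}^{2d}$ with $\{0\}\ne F\ne\mathbb{R}^{2d}$ is invariant under both $A$ and $B^2$. Then there exists $m\ge 1$ such that for every $\ell^*\in\mathbb{Z}$ there are integers $\ell_1,\dots,\ell_{m-1}>\ell^*$ for which the product $$B A^{\ell_1}\cdots B A^{\ell_{m-1}} B$$ is $k$-twisting with respect to $A$ for all $1\le k\le d$. -/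

import Mathlib

open Polynomial

/-- An integer-valued symplectic form on `ℤ^{2d}`, given by its Gram matrix `J`
(so that `Ω(x, y) = xᵀ J y`): it is antisymmetric and non-degenerate.
It need not be unimodular. -/
def IsIntSymplecticForm {d : ℕ} (J : Matrix (Fin (2 * d)) (Fin (2 * d)) ℤ) : Prop :=
  J.transpose = -J ∧ J.det ≠ 0

/-- The group `Sp(Ω, ℤ)` of the matrices in `SL(2d, ℤ)` that preserve `Ω`. -/
def SpInt {d : ℕ} (J : Matrix (Fin (2 * d)) (Fin (2 * d)) ℤ) :
    Subgroup (Matrix.SpecialLinearGroup (Fin (2 * d)) ℤ) where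
  carrier := {A | A.1.transpose * J * A.1 = J}
  one_mem' := by simp
  mul_mem' := by
    intro A B hA hB
    simp only [Set.mem_ofPred_eq] at hA hB ⊢
    calc (A * B).1.transpose * J * (A * B).1
        = B.1.transpose * (A.1.transpose * J * A.1) * B.1 := by
          change (A.1 * B.1).transpose * J * (A.1 * B.1) = _
          rw [Matrix.transpose_mul]
          simp only [Matrix.mul_assoc]
      _ = J := by rw [hA, hB]
  inv_mem' := by
    intro A hA
    simp only [Set.mem_ofPred_eq] at hA ⊢
    have h1 : A.1 * (A⁻¹).1 = 1 := by
      change ((A * A⁻¹ : Matrix.SpecialLinearGroup (Fin (2 * d)) ℤ)).1 = 1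
      rw [mul_inv_cancel]
      rfl
    have h2 : (A⁻¹).1.transpose * A.1.transpose = 1 := by
      rw [← Matrix.transpose_mul, h1, Matrix.transpose_one]
    calc (A⁻¹).1.transpose * J * (A⁻¹).1
        = (A⁻¹).1.transpose * (A.1.transpose * J * A.1) * (A⁻¹).1 := by rw [hA]
      _ = ((A⁻¹).1.transpose * A.1.transpose) * J * (A.1 * (A⁻¹).1) := by
          simp only [Matrix.mul_assoc]
      _ = J := by rw [h1, h2, Matrix.one_mul, Matrix.mul_one]

/-- The characteristic polynomial of an integer matrix, with coefficients regarded in `ℚ`. -/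
noncomputable def ratCharpoly {d : ℕ} (A : Matrix.SpecialLinearGroup (Fin (2 * d)) ℤ) : ℚ[X] :=
  A.1.charpoly.map (Int.castRingHom ℚ)

/-- The set `R = {μ + μ⁻¹ : μ a root of P}`, inside the splitting field of `P`. -/
def rootTraces {K : Type*} [Field K] (P : K[X]) : Set P.SplittingField :=
  (fun μ => μ + μ⁻¹) '' P.rootSet P.SplittingField

/-- The Galois group of the polynomial `P` (meant for reciprocal `P`) is the largest possible: it
acts on `R` by the full permutation group of `R`, and the subgroup fixing each element of `R` acts
by independent transpositions of the pairs `{μ, μ⁻¹}`, that is, for each subset `S` of `R` some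
element of the Galois group exchanges `μ` and `μ⁻¹` in the pairs indexed by `S` and fixes all the
other roots. -/
structure HasLargestGaloisGroup {K : Type*} [Field K] (P : K[X]) : Prop where
  full_perm : ∀ σ : Equiv.Perm (rootTraces P),
    ∃ g : P.SplittingField ≃ₐ[K] P.SplittingField, ∀ r : rootTraces P, g r = σ r
  indep_transpositions : ∀ S : Set P.SplittingField, S ⊆ rootTraces P →
    ∃ g : P.SplittingField ≃ₐ[K] P.SplittingField, ∀ μ ∈ P.rootSet P.SplittingField,
      (μ + μ⁻¹ ∈ S → g μ = μ⁻¹) ∧ (μ + μ⁻¹ ∉ S → g μ = μ)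

/-- `A` is Galois-pinching: its characteristic polynomial is irreducible over `ℚ`, all its
(complex) roots are real, and its Galois group is the largest possible. -/
structure IsGaloisPinching {d : ℕ} (A : Matrix.SpecialLinearGroup (Fin (2 * d)) ℤ) : Prop where
  irreducible : Irreducible (ratCharpoly A)
  real_roots : ∀ z : ℂ, aeval z (ratCharpoly A) = 0 → z.im = 0
  largest_galois : HasLargestGaloisGroup (ratCharpoly A)

/-- The action of an integer matrix on `ℝ^{2d}`. -/
noncomputable def realAction {d : ℕ} (A : Matrix.SpecialLinearGroup (Fin (2 * d)) ℤ) :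
    Module.End ℝ (Fin (2 * d) → ℝ) :=
  Matrix.toLin' (A.1.map (Int.castRingHom ℝ))

/-- The symplectic form `Ω` on `ℝ^{2d}`. -/
noncomputable def realForm {d : ℕ} (J : Matrix (Fin (2 * d)) (Fin (2 * d)) ℤ) :
    LinearMap.BilinForm ℝ (Fin (2 * d) → ℝ) :=
  Matrix.toBilin' (J.map (Int.castRingHom ℝ))

/-- The Grassmannian `G(k)` adapted to the symplectic group: the `k`-planes of `ℝ^{2d}` that are
isotropic if `k ≤ d` and coisotropic if `k ≥ d`. -/
def symplGrassmannian {d : ℕ} (J : Matrix (Fin (2 * d)) (Fin (2 * d)) ℤ) (k : ℕ) :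
    Set (Submodule ℝ (Fin (2 * d) → ℝ)) :=
  {F | Module.finrank ℝ F = k ∧
    (k ≤ d → F ≤ (realForm J).orthogonal F) ∧ (d ≤ k → (realForm J).orthogonal F ≤ F)}

/-- `C` is `k`-twisting with respect to `A`: `C(F) ∩ F' = {0}` for all `A`-invariant
`F ∈ G(k)` and `F' ∈ G(2d - k)`. -/
def IsTwisting {d : ℕ} (J : Matrix (Fin (2 * d)) (Fin (2 * d)) ℤ) (k : ℕ)
    (A C : Matrix.SpecialLinearGroup (Fin (2 * d)) ℤ) : Prop :=
  ∀ F ∈ symplGrassmannian J k, ∀ F' ∈ symplGrassmannian J (2 * d - k),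
    F ∈ (realAction A).invtSubmodule → F' ∈ (realAction A).invtSubmodule →
      F.map (realAction C) ⊓ F' = ⊥

/-- The product `B A^{ℓ_1} ⋯ B A^{ℓ_n} B` (which is `B` if `n = 0`). -/
def twistWord {G : Type*} [Group G] (A B : G) {n : ℕ} (l : Fin n → ℤ) : G :=
  (List.ofFn fun i => B * A ^ l i).prod * B

/-! Write V for the real space. For `A`-invariant `F` and `F'` of complementary dimension, C(F) ∩ F'
= 0 says that the determinant form ω of V/F' does not vanish at C x₁, …, C x_k, where x is a basis
of `F`. Along words C, this value is an exponential sum in each exponent separately. Its frequencies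
are products of eigenvalues of `A`, and the Galois hypothesis makes two of them equal once their
absolute values agree. So a sum that is not identically zero is nonzero for all large exponents
(`eventually_twistWord_ne_zero`). There are finitely many pairs (F, F'), so exponents can be
enlarged one at a time for all pairs together (`exists_common_tuple`). It remains to find, for each
pair and each large length, one word with arbitrary integer exponents that works.

Let U_n be the span of the pullbacks of ω along words with n exponents. Pullback B* is injective and
maps U_n into U_{n+1}, so dimensions stabilise; from then on U_{n+1} = B* U_n and U_n is `A`-stable
(`wordSpan_stabilizes`). The endomorphisms whose derivations preserve all these U_n form a space
stable under conjugation by `A` and `B`. It contains the Cartan subalgebra of the symplectic Lie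
algebra that is diagonal in the eigenbasis of `A`: by multiplicative independence, its derivations
are polynomials in A* (`formDerivation_mem_of_diagonal`). Galois symmetry and irreducibility under
`A` and `B ^ 2` give `B` enough nonzero entries (`symmetric_pattern_connected`) for conjugation by
`B` to produce every root vector, hence the whole symplectic Lie algebra (`symProd_mem`). So
symplectic transvections preserve U_n. A product of them makes `F` transverse to any subspace of
complementary dimension (`exists_mem_map_inf_eq_bot`), so U_n does not vanish on `F`, and neither do
all the words. -/

/-! ### Multilinear forms: pullbacks, derivations and spectral projections. -/

section MultilinearForms

variable {V : Type*} [AddCommGroup V] [Module ℝ V] {k : ℕ}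

/-- Precomposition of a multilinear form with an endomorphism in every argument. -/
noncomputable def formPullback (g : Module.End ℝ V) :
    Module.End ℝ (MultilinearMap ℝ (fun _ : Fin k => V) ℝ) :=
  MultilinearMap.compLinearMapₗ fun _ => g

@[simp] theorem formPullback_apply (g : Module.End ℝ V)
    (ω : MultilinearMap ℝ (fun _ : Fin k => V) ℝ) (x : Fin k → V) :
    formPullback g ω x = ω fun i => g (x i) := rfl

theorem formPullback_mul (g h : Module.End ℝ V) (ω : MultilinearMap ℝ (fun _ : Fin k => V) ℝ) :
    formPullback (g * h) ω = formPullback h (formPullback g ω) := rfl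

theorem formPullback_one (ω : MultilinearMap ℝ (fun _ : Fin k => V) ℝ) :
    formPullback (1 : Module.End ℝ V) ω = ω := rfl

/-- Precomposition of a multilinear form with an endomorphism in a single argument. -/
noncomputable def slotPullback (i : Fin k) :
    Module.End ℝ V →ₗ[ℝ] Module.End ℝ (MultilinearMap ℝ (fun _ : Fin k => V) ℝ) :=
  (MultilinearMap.compLinearMapMultilinear (R := ℝ) (M₁ := fun _ : Fin k => V)
    (M₁' := fun _ : Fin k => V) (M₂ := ℝ)).toLinearMap (fun _ => LinearMap.id) i

@[simp] theorem slotPullback_apply (i : Fin k) (X : Module.End ℝ V)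
    (ω : MultilinearMap ℝ (fun _ : Fin k => V) ℝ) (x : Fin k → V) :
    slotPullback i X ω x = ω (Function.update x i (X (x i))) := by
  simp only [slotPullback, MultilinearMap.toLinearMap_apply,
    MultilinearMap.compLinearMapMultilinear_apply, MultilinearMap.compLinearMapₗ_apply,
    MultilinearMap.compLinearMap_apply]
  congr 1
  funext j
  by_cases h : j = i
  · subst h; simp
  · simp [h]

/-- The action of an endomorphism on multilinear forms by derivations. -/
noncomputable def formDerivation :
    Module.End ℝ V →ₗ[ℝ] Module.End ℝ (MultilinearMap ℝ (fun _ : Fin k => V) ℝ) :=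
  ∑ i, slotPullback i

theorem formDerivation_eq_sum (X : Module.End ℝ V) :
    formDerivation (k := k) X = ∑ i, slotPullback i X := by
  simp [formDerivation]

theorem formDerivation_apply (X : Module.End ℝ V)
    (ω : MultilinearMap ℝ (fun _ : Fin k => V) ℝ) (x : Fin k → V) :
    formDerivation X ω x = ∑ i, ω (Function.update x i (X (x i))) := by
  rw [formDerivation_eq_sum, LinearMap.sum_apply, sum_apply]
  exact Finset.sum_congr rfl fun i _ => slotPullback_apply i X ω x

/-- Intertwining endomorphisms act by intertwined derivations. -/
theorem formDerivation_formPullback {X Y g : Module.End ℝ V} (h : g * X = Y * g)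
    (ω : MultilinearMap ℝ (fun _ : Fin k => V) ℝ) :
    formDerivation X (formPullback g ω) = formPullback g (formDerivation Y ω) := by
  ext x
  rw [formPullback_apply, formDerivation_apply, formDerivation_apply]
  refine Finset.sum_congr rfl fun i _ => ?_
  rw [formPullback_apply]
  congr 1
  funext j
  by_cases hj : j = i
  · subst hj
    simpa using LinearMap.congr_fun h (x j)
  · simp [hj]

theorem slotPullback_commute {i j : Fin k} (h : i ≠ j) (X Y : Module.End ℝ V) :
    Commute (slotPullback i X) (slotPullback j Y) := by
  refine LinearMap.ext fun ω => MultilinearMap.ext fun x => ?_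
  simp only [Module.End.mul_apply, slotPullback_apply]
  rw [Function.update_of_ne h.symm, Function.update_of_ne h, Function.update_comm h]

theorem slotPullback_sq {i : Fin k} {X : Module.End ℝ V} (h : X * X = 0) :
    slotPullback i X ^ 2 = 0 := by
  refine LinearMap.ext fun ω => MultilinearMap.ext fun x => ?_
  have h' : X (X (x i)) = 0 := LinearMap.congr_fun h (x i)
  simp [pow_two, h']

/-- For `X ^ 2 = 0`, a subspace of forms invariant under the derivation `X` is invariant under
pulling back along `exp X = 1 + X`. -/
theorem formPullback_one_add_mem {X : Module.End ℝ V} (hX : X * X = 0)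
    {U : Submodule ℝ (MultilinearMap ℝ (fun _ : Fin k => V) ℝ)}
    (hU : ∀ ω ∈ U, formDerivation X ω ∈ U) {ω : MultilinearMap ℝ (fun _ : Fin k => V) ℝ}
    (hω : ω ∈ U) : formPullback (1 + X) ω ∈ U := by
  -- `IsNilpotent.exp` needs rational scalars; they are made to act through ℝ, so that `U` is closed
  -- under them.
  let _ : Module ℚ (Module.End ℝ (MultilinearMap ℝ (fun _ : Fin k => V) ℝ)) :=
    Module.compHom _ (algebraMap ℚ ℝ)
  -- The slot operators commute and square to zero, so the exponential of their sum is the product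
  -- of the factors 1 + (slot operator), each of which applies 1 + X in one slot.
  have key : ∀ s : Finset (Fin k), IsNilpotent (∑ i ∈ s, slotPullback i X) ∧
      ∀ η x, IsNilpotent.exp (∑ i ∈ s, slotPullback i X) η x =
        η fun i => if i ∈ s then x i + X (x i) else x i := by
    intro s
    induction s using Finset.induction_on with
    | empty => exact ⟨by simp, fun η x => by simp⟩
    | insert a s ha ih =>
      obtain ⟨ih1, ih2⟩ := ih
      have hc : Commute (slotPullback a X) (∑ i ∈ s, slotPullback i X) :=
        Commute.sum_right _ _ _ fun i hi =>
          slotPullback_commute (fun h : a = i => ha (by rwa [h])) X X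
      have hn : IsNilpotent (slotPullback a X) := ⟨2, slotPullback_sq hX⟩
      rw [Finset.sum_insert ha]
      refine ⟨hc.isNilpotent_add hn ih1, fun η x => ?_⟩
      rw [IsNilpotent.exp_add_of_commute hc hn ih1,
        IsNilpotent.exp_eq_sum (slotPullback_sq hX)]
      simp only [Finset.sum_range_succ, Finset.sum_range_zero, zero_add, Nat.factorial,
        pow_zero, pow_one, Nat.cast_one, inv_one, one_smul, mul_one]
      rw [Module.End.mul_apply, LinearMap.add_apply, Module.End.one_apply,
        add_apply, slotPullback_apply, ih2, ih2]
      set y : Fin k → V := fun i => if i ∈ s then x i + X (x i) else x i with hy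
      have e1 : (fun i => if i ∈ s then Function.update x a (X (x a)) i +
          X (Function.update x a (X (x a)) i) else Function.update x a (X (x a)) i) =
          Function.update y a (X (x a)) := by
        funext i
        by_cases h : i = a
        · subst h; simp [ha]
        · simp [h, hy]
      have e2 : (fun i => if i ∈ insert a s then x i + X (x i) else x i) =
          Function.update y a (x a + X (x a)) := by
        funext i
        by_cases h : i = a
        · subst h; simp
        · simp [h, hy]
      have e3 : y = Function.update y a (x a) := by
        funext i
        by_cases h : i = a
        · subst h; simp [ha, hy]
        · simp [h]
      rw [e1, e2, MultilinearMap.map_update_add, ← e3]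
  have h1 : formPullback (1 + X) ω = IsNilpotent.exp (formDerivation X) ω := by
    ext x
    rw [formDerivation_eq_sum, (key Finset.univ).2]
    simp
  have h2 : ∀ n, (formDerivation X ^ n) ω ∈ U := by
    intro n
    induction n with
    | zero => simpa using hω
    | succ n ih => rw [pow_succ']; exact hU _ ih
  rw [h1, IsNilpotent.exp, LinearMap.sum_apply]
  exact U.sum_mem fun i _ => U.smul_mem (algebraMap ℚ ℝ (i.factorial : ℚ)⁻¹) (h2 i)

theorem formPullback_apply_basis {ι : Type*} {v : ι → V} {a : Module.End ℝ V} {c : ι → ℝ}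
    (ha : ∀ i, a (v i) = c i • v i) (ω : MultilinearMap ℝ (fun _ : Fin k => V) ℝ)
    (f : Fin k → ι) :
    formPullback a ω (fun i => v (f i)) = (∏ i, c (f i)) * ω fun i => v (f i) := by
  simp only [formPullback_apply, ha]
  rw [MultilinearMap.map_smul_univ, smul_eq_mul]

theorem formDerivation_apply_basis {ι : Type*} {v : ι → V} {H : Module.End ℝ V} {h : ι → ℝ}
    (hH : ∀ i, H (v i) = h i • v i) (ω : MultilinearMap ℝ (fun _ : Fin k => V) ℝ)
    (f : Fin k → ι) :
    formDerivation H ω (fun i => v (f i)) = (∑ i, h (f i)) * ω fun i => v (f i) := by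
  rw [formDerivation_apply, Finset.sum_mul]
  refine Finset.sum_congr rfl fun i _ => ?_
  rw [hH, MultilinearMap.map_update_smul, Function.update_eq_self (f := fun i => v (f i)),
    smul_eq_mul]

theorem aeval_mem_of_invariant {M : Type*} [AddCommGroup M] [Module ℝ M] {T : Module.End ℝ M}
    {U : Submodule ℝ M} (hU : ∀ u ∈ U, T u ∈ U) (p : ℝ[X]) {u : M} (hu : u ∈ U) :
    aeval T p u ∈ U := by
  induction p using Polynomial.induction_on' with
  | add p q hp hq => rw [map_add]; exact U.add_mem hp hq
  | monomial n c =>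
    have h2 : (T ^ n) u ∈ U := by
      induction n with
      | zero => simpa using hu
      | succ n ih => rw [pow_succ']; exact hU _ ih
    rw [aeval_monomial]
    exact U.smul_mem c h2

/-- Polynomial interpolation of a function that factors through another one. -/
theorem exists_polynomial_eval_eq {κ : Type*} [Finite κ] (μ h : κ → ℝ)
    (hμ : ∀ f g, μ f = μ g → h f = h g) : ∃ p : ℝ[X], ∀ f, p.eval (μ f) = h f := by
  classical
  cases nonempty_fintype κ
  -- The value 0 off the range of `μ` is never used.
  let r : ℝ → ℝ := fun x => if hx : ∃ f, μ f = x then h hx.choose else 0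
  refine ⟨Lagrange.interpolate (Finset.univ.image μ) id r, fun f => ?_⟩
  have h1 := Lagrange.eval_interpolate_at_node (s := Finset.univ.image μ) (v := id) r
    (i := μ f) (Set.injOn_id _) (by simp)
  have hx : ∃ g, μ g = μ f := ⟨f, rfl⟩
  rw [id] at h1
  rw [h1]
  simp only [r, dif_pos hx]
  exact hμ _ _ hx.choose_spec

/-- A diagonal derivation whose weights are determined by the eigenvalues of a diagonal
endomorphism preserves every subspace of forms that is invariant under this endomorphism. -/
theorem formDerivation_mem_of_diagonal {ι : Type*} [Finite ι] (v : Module.Basis ι ℝ V)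
    {a H : Module.End ℝ V} {c h : ι → ℝ} (ha : ∀ i, a (v i) = c i • v i)
    (hH : ∀ i, H (v i) = h i • v i)
    (hch : ∀ f g : Fin k → ι, ∏ i, c (f i) = ∏ i, c (g i) → ∑ i, h (f i) = ∑ i, h (g i))
    {U : Submodule ℝ (MultilinearMap ℝ (fun _ : Fin k => V) ℝ)}
    (hU : ∀ ω ∈ U, formPullback a ω ∈ U) {ω : MultilinearMap ℝ (fun _ : Fin k => V) ℝ}
    (hω : ω ∈ U) : formDerivation H ω ∈ U := by
  obtain ⟨p, hp⟩ := exists_polynomial_eval_eq (fun f : Fin k → ι => ∏ i, c (f i))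
    (fun f => ∑ i, h (f i)) hch
  have hpow : ∀ (n : ℕ) (f : Fin k → ι), ((formPullback a ^ n) ω) (fun i => v (f i)) =
      (∏ i, c (f i)) ^ n * ω fun i => v (f i) := by
    intro n f
    induction n with
    | zero => simp
    | succ n ih =>
      rw [pow_succ', Module.End.mul_apply, formPullback_apply_basis ha, ih, pow_succ']
      ring
  -- On a tuple of basis vectors, pullback by `a` multiplies by a product of `c`'s and the
  -- derivation by a sum of `h`'s. By `hch` the sum is a function of the product, and `p`
  -- interpolates this function.
  have heq : formDerivation H ω = aeval (formPullback a) p ω := by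
    refine Module.Basis.ext_multilinear (fun _ => v) fun f => ?_
    rw [formDerivation_apply_basis hH, ← hp f, aeval_eq_sum_range, eval_eq_sum_range,
      LinearMap.sum_apply, sum_apply, Finset.sum_mul]
    refine Finset.sum_congr rfl fun n _ => ?_
    rw [LinearMap.smul_apply, smul_apply, hpow, smul_eq_mul, mul_assoc]
  rw [heq]
  exact aeval_mem_of_invariant hU p hω

/-- An invariant subspace contains the component of each of its elements on which a
diagonalised endomorphism has a prescribed eigenvalue. -/
theorem sum_eigencomponent_mem {M κ : Type*} [AddCommGroup M] [Module ℝ M] [Fintype κ]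
    {T : Module.End ℝ M} {U : Submodule ℝ M} (hU : ∀ u ∈ U, T u ∈ U) (x : κ → M) (μ : κ → ℝ)
    (hx : ∀ f, T (x f) = μ f • x f) (hmem : ∑ f, x f ∈ U) (r : ℝ) :
    ∑ f with μ f = r, x f ∈ U := by
  classical
  -- `p` is 1 at `r` and 0 at the other eigenvalues, so `p(T)` is the spectral projection.
  obtain ⟨p, hp⟩ := exists_polynomial_eval_eq μ (fun f => if μ f = r then (1 : ℝ) else 0)
    (fun f g h => by simp [h])
  have hev : ∀ f, aeval T p (x f) = p.eval (μ f) • x f := by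
    intro f
    have hpow : ∀ n : ℕ, (T ^ n) (x f) = μ f ^ n • x f := by
      intro n
      induction n with
      | zero => simp
      | succ n ih => rw [pow_succ', Module.End.mul_apply, ih, map_smul, hx, smul_smul, pow_succ]
    rw [aeval_eq_sum_range, eval_eq_sum_range, LinearMap.sum_apply, Finset.sum_smul]
    refine Finset.sum_congr rfl fun n _ => ?_
    rw [LinearMap.smul_apply, hpow, smul_smul]
  have h := aeval_mem_of_invariant hU p hmem
  rw [map_sum] at h
  rw [Finset.sum_filter]
  convert h using 2 with f
  rw [hev, hp]
  split_ifs <;> simp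

end MultilinearForms

/-! ### The symplectic Lie algebra, transvections and transversality. -/

section Symplectic

variable {V : Type*} [AddCommGroup V] [Module ℝ V]

/-- The element `u ⬝ w` of the symplectic Lie algebra, under its identification with the symmetric
square of the space: the endomorphism `x ↦ Ω(x, u) w + Ω(x, w) u`. -/
noncomputable def symProd (Ω : LinearMap.BilinForm ℝ V) : V →ₗ[ℝ] V →ₗ[ℝ] Module.End ℝ V :=
  LinearMap.mk₂ ℝ (fun u w => (Ω.flip u).smulRight w + (Ω.flip w).smulRight u)
    (fun u u' w => by ext x; simp [add_smul]; abel)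
    (fun c u w => by ext x; simp [smul_smul, mul_comm])
    (fun u w w' => by ext x; simp [add_smul]; abel)
    (fun c u w => by ext x; simp [smul_smul, mul_comm])

theorem symProd_apply (Ω : LinearMap.BilinForm ℝ V) (u w x : V) :
    symProd Ω u w x = Ω x u • w + Ω x w • u := rfl

theorem symProd_comm (Ω : LinearMap.BilinForm ℝ V) (u w : V) :
    symProd Ω u w = symProd Ω w u := by
  ext x
  simp [symProd_apply, add_comm]

theorem mul_symProd {Ω : LinearMap.BilinForm ℝ V} {g : Module.End ℝ V}
    (hg : ∀ x y, Ω (g x) (g y) = Ω x y) (u w : V) :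
    g * symProd Ω u w = symProd Ω (g u) (g w) * g := by
  ext x
  simp [symProd_apply, hg]

/-- This makes 1 + w ⬝ w, a transvection along `w`, the exponential of an element of the Lie
algebra. -/
theorem symProd_self_mul_self {Ω : LinearMap.BilinForm ℝ V} (hΩ : ∀ x, Ω x x = 0) (w : V) :
    symProd Ω w w * symProd Ω w w = 0 := by
  ext x
  simp [symProd_apply, hΩ]

theorem exists_notMem_notMem {P Q : Submodule ℝ V} (hP : P ≠ ⊤) (hQ : Q ≠ ⊤) :
    ∃ w, w ∉ P ∧ w ∉ Q := by
  obtain ⟨p, hp⟩ : ∃ p, p ∉ P := by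
    by_contra! h
    exact hP (eq_top_iff.2 fun x _ => h x)
  obtain ⟨q, hq⟩ : ∃ q, q ∉ Q := by
    by_contra! h
    exact hQ (eq_top_iff.2 fun x _ => h x)
  by_cases hpQ : p ∈ Q
  · by_cases hqP : q ∈ P
    · exact ⟨p + q, fun h => hp ((P.add_mem_iff_left hqP).1 h),
        fun h => hq ((Q.add_mem_iff_right hpQ).1 h)⟩
    · exact ⟨q, hqP, hq⟩
  · exact ⟨p, hp, hpQ⟩

/-- Symplectic transvections generate enough to move any subspace into a position transverse to
a given subspace of complementary dimension. -/
theorem exists_mem_map_inf_eq_bot [FiniteDimensional ℝ V] {Ω : LinearMap.BilinForm ℝ V}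
    (hΩ : ∀ x, Ω x x = 0) (hnd : ∀ u, u ≠ 0 → ∃ w, Ω u w ≠ 0)
    {M : Submonoid (Module.End ℝ V)} (hM : ∀ w, 1 + symProd Ω w w ∈ M)
    (F F' : Submodule ℝ V)
    (hdim : Module.finrank ℝ F + Module.finrank ℝ F' = Module.finrank ℝ V) :
    ∃ g ∈ M, F.map g ⊓ F' = ⊥ := by
  induction hn : Module.finrank ℝ (F ⊓ F' : Submodule ℝ V) using Nat.strong_induction_on
    generalizing F with
  | _ n ih =>
  by_cases hbot : F ⊓ F' = ⊥
  · refine ⟨1, M.one_mem, ?_⟩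
    rw [show F.map (1 : Module.End ℝ V) = F from Submodule.map_id F, hbot]
  · obtain ⟨u, hu, hu0⟩ := Submodule.exists_mem_ne_zero_of_ne_bot hbot
    have hsup : F ⊔ F' ≠ ⊤ := by
      intro h
      have h1 := Submodule.finrank_sup_add_finrank_inf_eq F F'
      rw [h, finrank_top, hdim] at h1
      exact hbot (Submodule.finrank_eq_zero.1 (by omega))
    have hker : LinearMap.ker (Ω u) ≠ ⊤ := by
      intro h
      obtain ⟨w, hw⟩ := hnd u hu0
      exact hw (by simpa using (h ▸ Submodule.mem_top : w ∈ LinearMap.ker (Ω u)))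
    -- As `w ∉ F + F'`, the transvection along `w` creates no new intersection. As Ω(u, w) ≠ 0, it
    -- moves `u` out of the old one, so the dimension of the intersection drops.
    obtain ⟨w, hw1, hw2⟩ := exists_notMem_notMem hsup hker
    set τ : Module.End ℝ V := 1 + symProd Ω w w with hτ
    have hτx : ∀ x, τ x = x + (2 * Ω x w) • w := by
      intro x
      rw [hτ, LinearMap.add_apply, Module.End.one_apply, symProd_apply, ← add_smul, two_mul]
    have hinj : Function.Injective τ := by
      rw [injective_iff_map_eq_zero]
      intro x hx
      have h1 : Ω x w = 0 := by
        have := congrArg (fun y => Ω y w) hx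
        simpa [hτx, hΩ] using this
      simpa [hτx, h1] using hx
    have hfix : ∀ x ∈ F, τ x ∈ F' → Ω x w = 0 ∧ τ x = x := by
      intro x hx hx'
      have h1 : Ω x w = 0 := by
        by_contra h
        refine hw1 ?_
        have h2 : (2 * Ω x w) • w ∈ F ⊔ F' := by
          have : (2 * Ω x w) • w = -x + τ x := by rw [hτx]; abel
          rw [this]
          exact Submodule.add_mem _ (Submodule.mem_sup_left (F.neg_mem hx))
            (Submodule.mem_sup_right hx')
        exact (Submodule.smul_mem_iff _ (by simpa using h)).1 h2
      exact ⟨h1, by simp [hτx, h1]⟩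
    have hlt : F.map τ ⊓ F' < F ⊓ F' := by
      refine lt_of_le_of_ne ?_ ?_
      · rintro y ⟨⟨x, hx, rfl⟩, hy⟩
        have := (hfix x hx hy).2
        rw [this] at hy ⊢
        exact ⟨hx, hy⟩
      · intro h
        rw [← h] at hu
        obtain ⟨⟨x, hx, hxu⟩, hu'⟩ := hu
        rw [← hxu] at hu'
        obtain ⟨h1, h2⟩ := hfix x hx hu'
        rw [h2] at hxu
        exact hw2 (by simpa [← hxu] using h1)
    have hF : Module.finrank ℝ (F.map τ) = Module.finrank ℝ F :=
      (Submodule.equivMapOfInjective τ hinj F).finrank_eq.symm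
    obtain ⟨g, hg, hgF⟩ := ih _ (hn ▸ Submodule.finrank_lt_finrank_of_lt hlt) (F.map τ)
      (by rw [hF, hdim]) rfl
    refine ⟨g * τ, M.mul_mem hg (hM w), ?_⟩
    rw [← hgF, ← Submodule.map_comp]
    rfl

/-- The determinant form on a quotient space, pulled back to the space: it detects whether a
tuple of vectors projects to a basis of the quotient. -/
noncomputable def quotientDetForm {k : ℕ} {F' : Submodule ℝ V}
    (b : Module.Basis (Fin k) ℝ (V ⧸ F')) : MultilinearMap ℝ (fun _ : Fin k => V) ℝ :=
  b.det.toMultilinearMap.compLinearMap fun _ => F'.mkQ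

/-- The determinant tests whether F → V/F', induced by `C`, takes a basis to a basis; both spaces
have dimension `k`, so only injectivity is at stake. -/
theorem quotientDetForm_ne_zero_iff {k : ℕ} {F F' : Submodule ℝ V}
    (b : Module.Basis (Fin k) ℝ (V ⧸ F')) (x : Module.Basis (Fin k) ℝ F)
    {C : Module.End ℝ V} (hC : Function.Injective C) :
    quotientDetForm b (fun i => C (x i)) ≠ 0 ↔ F.map C ⊓ F' = ⊥ := by
  have hform : quotientDetForm b (fun i => C (x i)) = b.det fun i => F'.mkQ (C (x i)) := rfl
  let T : F →ₗ[ℝ] V ⧸ F' := F'.mkQ ∘ₗ C ∘ₗ F.subtype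
  have hT : (fun i => F'.mkQ (C (x i))) = T ∘ x := rfl
  have hbot : F.map C ⊓ F' = ⊥ ↔ LinearMap.ker T = ⊥ := by
    rw [Submodule.eq_bot_iff, LinearMap.ker_eq_bot']
    constructor
    · intro h y hy
      have h1 : C y ∈ F' := by simpa [T] using hy
      have h2 := h (C y) ⟨⟨y, y.2, rfl⟩, h1⟩
      exact Subtype.ext (hC (by simpa using h2))
    · rintro h _ ⟨⟨y, hy, rfl⟩, hy'⟩
      have := h ⟨y, hy⟩ (by simpa [T] using hy')
      rw [Submodule.mk_eq_zero] at this
      simp [this]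
  rw [hform, hT, hbot, ← isUnit_iff_ne_zero, ← b.is_basis_iff_det]
  constructor
  · rintro ⟨hli, -⟩
    rw [LinearMap.ker_eq_bot']
    intro y hy
    rw [← x.sum_repr y, map_sum] at hy
    simp only [map_smul] at hy
    have := Fintype.linearIndependent_iff.1 hli _ hy
    rw [← x.sum_repr y]
    simp [this]
  · intro h
    have hli := x.linearIndependent.map' T h
    refine ⟨hli, ?_⟩
    have : FiniteDimensional ℝ (V ⧸ F') := Module.Basis.finiteDimensional_of_finite b
    exact hli.span_eq_top_of_card_eq_finrank' (by rw [Module.finrank_eq_card_basis b])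

end Symplectic

/-! ### Exponential sums and simultaneous choice of exponents. -/

section ExponentialSums

open Filter Topology

theorem tendsto_zpow_atTop_nhds_zero {q : ℝ} (hq : |q| < 1) :
    Tendsto (fun l : ℤ => q ^ l) atTop (𝓝 0) := by
  have h := (tendsto_pow_atTop_nhds_zero_of_abs_lt_one hq).comp
    (tendsto_atTop.2 fun n : ℕ => (eventually_ge_atTop (n : ℤ)).mono fun l hl =>
      (Int.le_toNat (by omega)).2 hl : Tendsto Int.toNat atTop atTop)
  refine h.congr' ?_
  filter_upwards [eventually_ge_atTop (0 : ℤ)] with l hl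
  rw [Function.comp_apply, ← zpow_natCast, Int.toNat_of_nonneg hl]

/-- An exponential sum whose distinct frequencies have distinct absolute values has no zeros near
`+∞`, unless it vanishes identically. -/
theorem eventually_expSum_ne_zero {κ : Type*} [Fintype κ] (c μ : κ → ℝ) (hμ : ∀ f, μ f ≠ 0)
    (habs : ∀ f g, |μ f| = |μ g| → μ f = μ g) {l₀ : ℤ} (h₀ : ∑ f, c f * μ f ^ l₀ ≠ 0) :
    ∀ᶠ l : ℤ in atTop, ∑ f, c f * μ f ^ l ≠ 0 := by
  classical
  -- Equal frequencies are merged and zero coefficients discarded. The remaining frequency `r₀` of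
  -- largest absolute value is then strictly dominant by `habs`, and the sum divided by `r₀ ^ l`
  -- tends to `c' r₀ ≠ 0`.
  set c' : ℝ → ℝ := fun r => ∑ f with μ f = r, c f with hc'
  set s := Finset.univ.image μ with hs
  set s' := s.filter fun r => c' r ≠ 0 with hs'
  have hsum : ∀ l : ℤ, ∑ f, c f * μ f ^ l = ∑ r ∈ s', c' r * r ^ l := by
    intro l
    rw [hs', Finset.sum_filter_of_ne (fun r _ h => left_ne_zero_of_mul h),
      ← Finset.sum_fiberwise_of_maps_to (g := μ) (t := s) (fun f _ => by simp [hs])]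
    refine Finset.sum_congr rfl fun r _ => ?_
    rw [hc', Finset.sum_mul]
    refine Finset.sum_congr rfl fun f hf => ?_
    rw [(Finset.mem_filter.1 hf).2]
  have hne : s'.Nonempty := by
    rw [Finset.nonempty_iff_ne_empty]
    intro h
    exact h₀ (by rw [hsum, h, Finset.sum_empty])
  obtain ⟨r₀, hr₀, hmax⟩ := Finset.exists_max_image s' (fun r => |r|) hne
  have hs_ne : ∀ r ∈ s', r ≠ 0 := by
    intro r hr
    obtain ⟨f, -, rfl⟩ := Finset.mem_image.1 (Finset.mem_filter.1 hr).1
    exact hμ f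
  have hlim : Tendsto (fun l : ℤ => ∑ r ∈ s', c' r * (r / r₀) ^ l) atTop
      (𝓝 (∑ r ∈ s', if r = r₀ then c' r else 0)) := by
    refine tendsto_finsetSum _ fun r hr => ?_
    by_cases h : r = r₀
    · simp [h, div_self (hs_ne r₀ hr₀)]
    · rw [if_neg h]
      have hlt : |r / r₀| < 1 := by
        rw [abs_div, div_lt_one (abs_pos.2 (hs_ne r₀ hr₀))]
        refine lt_of_le_of_ne (hmax r hr) fun he => h ?_
        obtain ⟨f, -, rfl⟩ := Finset.mem_image.1 (Finset.mem_filter.1 hr).1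
        obtain ⟨g, -, rfl⟩ := Finset.mem_image.1 (Finset.mem_filter.1 hr₀).1
        exact habs f g he
      simpa using (tendsto_zpow_atTop_nhds_zero hlt).const_mul (c' r)
  rw [Finset.sum_ite_eq' s' r₀, if_pos hr₀] at hlim
  filter_upwards [hlim.eventually_ne (Finset.mem_filter.1 hr₀).2] with l hl h
  refine hl ?_
  rw [hsum] at h
  have : ∑ r ∈ s', c' r * (r / r₀) ^ l = (∑ r ∈ s', c' r * r ^ l) / r₀ ^ l := by
    rw [Finset.sum_div]
    exact Finset.sum_congr rfl fun r _ => by rw [div_zpow, mul_div_assoc]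
  rw [this, h, zero_div]

/-- Finitely many nonempty conditions on integer tuples, each of which is stable under changing a
single coordinate to any large enough value, have a common solution with large coordinates. -/
theorem exists_common_tuple {n : ℕ} {I : Type*} [Finite I] (P : I → (Fin n → ℤ) → Prop)
    (hP : ∀ i l, P i l → ∀ j, ∀ᶠ x : ℤ in atTop, P i (Function.update l j x))
    (hne : ∀ i, ∃ l, P i l) (L : ℤ) : ∃ l : Fin n → ℤ, (∀ j, L < l j) ∧ ∀ i, P i l := by
  classical
  -- Each condition keeps its own witness; the coordinates in `s` have already been replaced by
  -- large values common to all witnesses.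
  have key : ∀ s : Finset (Fin n), ∃ (l : I → Fin n → ℤ) (c : Fin n → ℤ),
      ∀ i, P i (l i) ∧ ∀ j ∈ s, l i j = c j ∧ L < c j := by
    intro s
    induction s using Finset.induction_on with
    | empty =>
      choose l hl using hne
      exact ⟨l, 0, fun i => ⟨hl i, by simp⟩⟩
    | insert a s ha ih =>
      obtain ⟨l, c, h⟩ := ih
      obtain ⟨x, hx, hLx⟩ := ((eventually_all.2 fun i => hP i (l i) (h i).1 a).and
        (eventually_gt_atTop L)).exists
      refine ⟨fun i => Function.update (l i) a x, Function.update c a x, fun i => ⟨hx i, ?_⟩⟩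
      intro j hj
      by_cases hja : j = a
      · subst hja; simpa using hLx
      · simpa [hja] using (h i).2 j (Finset.mem_of_mem_insert_of_ne hj hja)
  obtain ⟨l, c, h⟩ := key Finset.univ
  rcases isEmpty_or_nonempty I with hI | ⟨⟨i₀⟩⟩
  · exact ⟨fun _ => L + 1, fun _ => lt_add_one L, fun i => hI.elim i⟩
  · have hlc : ∀ i, l i = c := fun i => funext fun j => ((h i).2 j (Finset.mem_univ j)).1
    exact ⟨c, fun j => ((h i₀).2 j (Finset.mem_univ j)).2, fun i => hlc i ▸ (h i).1⟩

end ExponentialSums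

/-! ### Words in `A` and `B` and the spans of their pullbacks. -/

section Words

open Filter

theorem twistWord_succ {G : Type*} [Group G] (A B : G) {n : ℕ} (l : Fin (n + 1) → ℤ) :
    twistWord A B l = twistWord A B (fun i : Fin n => l i.castSucc) *
      (A ^ l (Fin.last n) * B) := by
  rw [twistWord, List.ofFn_succ', List.concat_eq_append, List.prod_append, twistWord]
  simp [mul_assoc]

theorem twistWord_zero_exponents {G : Type*} [Group G] (A B : G) (n : ℕ) :
    twistWord A B (fun _ : Fin n => (0 : ℤ)) = B ^ (n + 1) := by
  simp [twistWord, pow_succ]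

theorem exists_twistWord_update {G : Type*} [Group G] (A B : G) {n : ℕ} (l : Fin n → ℤ)
    (j : Fin n) : ∃ X Y : G, ∀ x, twistWord A B (Function.update l j x) = X * A ^ x * Y := by
  induction n with
  | zero => exact j.elim0
  | succ n ih =>
    induction j using Fin.lastCases with
    | last =>
      refine ⟨twistWord A B fun i : Fin n => l i.castSucc, B, fun x => ?_⟩
      rw [twistWord_succ]
      simp [mul_assoc, (Fin.castSucc_lt_last _).ne]
    | cast j =>
      obtain ⟨X, Y, h⟩ := ih (fun i => l i.castSucc) j
      refine ⟨X, Y * (A ^ l (Fin.last n) * B), fun x => ?_⟩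
      rw [twistWord_succ, ← mul_assoc (X * A ^ x), ← h x]
      congr 2
      · funext i
        by_cases hi : i = j
        · subst hi; simp
        · simp [hi]
      · simp [(Fin.castSucc_lt_last j).ne']

variable {G V : Type*} [Group G] [AddCommGroup V] [Module ℝ V] {k : ℕ}

theorem representation_zpow_apply_eigenvector (ρ : Representation ℝ G V) {A : G} {x : V} {c : ℝ}
    (hc : c ≠ 0) (h : ρ A x = c • x) (n : ℤ) : ρ (A ^ n) x = c ^ n • x := by
  have hinv : ρ A⁻¹ x = c⁻¹ • x := by
    have h1 : ρ A⁻¹ (ρ A x) = x := by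
      rw [← Module.End.mul_apply, ← map_mul, inv_mul_cancel, map_one, Module.End.one_apply]
    rw [h, map_smul] at h1
    rw [← h1, smul_smul, inv_mul_cancel₀ hc, one_smul, h1]
  induction n using Int.induction_on with
  | zero => simp
  | succ n ih =>
    rw [zpow_add_one, map_mul, Module.End.mul_apply, h, map_smul, ih, smul_smul,
      zpow_add_one₀ hc, mul_comm]
  | pred n ih =>
    rw [zpow_sub_one, map_mul, Module.End.mul_apply, hinv, map_smul, ih, smul_smul,
      zpow_sub_one₀ hc, mul_comm]

/-- The span of the pullbacks of a multilinear form along all the words of a given length. -/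
noncomputable def wordSpan (ρ : Representation ℝ G V) (A B : G)
    (ω : MultilinearMap ℝ (fun _ : Fin k => V) ℝ) (n : ℕ) :
    Submodule ℝ (MultilinearMap ℝ (fun _ : Fin k => V) ℝ) :=
  Submodule.span ℝ (Set.range fun l : Fin n → ℤ => formPullback (ρ (twistWord A B l)) ω)

/-- Pullback is contravariant, so it is appending A^x B at the right end of a word that acts on the
span. -/
theorem wordSpan_step {ρ : Representation ℝ G V} {A B : G}
    {ω : MultilinearMap ℝ (fun _ : Fin k => V) ℝ} {n : ℕ}
    {u : MultilinearMap ℝ (fun _ : Fin k => V) ℝ} (hu : u ∈ wordSpan ρ A B ω n) (x : ℤ) :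
    formPullback (ρ B) (formPullback (ρ (A ^ x)) u) ∈ wordSpan ρ A B ω (n + 1) := by
  rw [← formPullback_mul, ← map_mul]
  refine (Submodule.span_le (p := (wordSpan ρ A B ω (n + 1)).comap
    (formPullback (ρ (A ^ x * B))))).2 ?_ hu
  rintro _ ⟨l, rfl⟩
  refine Submodule.subset_span ⟨Fin.snoc (α := fun _ => ℤ) l x, ?_⟩
  simp only [twistWord_succ, Fin.snoc_castSucc, Fin.snoc_last]
  rw [map_mul, formPullback_mul]

theorem formPullback_inv_self (ρ : Representation ℝ G V) (g : G)
    (ω : MultilinearMap ℝ (fun _ : Fin k => V) ℝ) :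
    formPullback (ρ g⁻¹) (formPullback (ρ g) ω) = ω := by
  rw [← formPullback_mul, ← map_mul, mul_inv_cancel, map_one, formPullback_one]

theorem formPullback_injective (ρ : Representation ℝ G V) (g : G) :
    Function.Injective (formPullback (k := k) (ρ g)) :=
  Function.LeftInverse.injective (formPullback_inv_self ρ g)

/-- The spans of long words are eventually invariant under `A`, and each of them is the pullback
of the preceding one under `B`. -/
theorem wordSpan_stabilizes [FiniteDimensional ℝ V] (ρ : Representation ℝ G V) (A B : G)
    (ω : MultilinearMap ℝ (fun _ : Fin k => V) ℝ) :
    ∃ N, ∀ n, N ≤ n →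
      wordSpan ρ A B ω (n + 1) = (wordSpan ρ A B ω n).map (formPullback (ρ B)) ∧
      ∀ u ∈ wordSpan ρ A B ω n, ∀ x : ℤ, formPullback (ρ (A ^ x)) u ∈ wordSpan ρ A B ω n := by
  set U := wordSpan ρ A B ω
  have hle : ∀ n, (U n).map (formPullback (ρ B)) ≤ U (n + 1) := by
    rintro n _ ⟨u, hu, rfl⟩
    have h := wordSpan_step hu 0
    rwa [zpow_zero, map_one, formPullback_one] at h
  have hmapdim : ∀ n, Module.finrank ℝ ((U n).map (formPullback (ρ B))) =
      Module.finrank ℝ (U n) := fun n =>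
    (Submodule.equivMapOfInjective _ (formPullback_injective ρ B) _).finrank_eq.symm
  have hmono : Monotone fun n => Module.finrank ℝ (U n) := by
    refine monotone_nat_of_le_succ fun n => ?_
    rw [← hmapdim n]
    exact Submodule.finrank_mono (hle n)
  -- `N` realises the maximal dimension; by monotonicity every later span has this dimension too.
  obtain ⟨N, hN⟩ : ∃ N, ∀ n, Module.finrank ℝ (U n) ≤ Module.finrank ℝ (U N) := by
    have hb : BddAbove (Set.range fun n => Module.finrank ℝ (U n)) :=
      ⟨_, by rintro _ ⟨n, rfl⟩; exact Submodule.finrank_le (U n)⟩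
    obtain ⟨N, hN⟩ := Nat.sSup_mem (Set.range_nonempty _) hb
    exact ⟨N, fun n => (le_csSup hb ⟨n, rfl⟩).trans hN.ge⟩
  refine ⟨N, fun n hn => ?_⟩
  have heq : (U n).map (formPullback (ρ B)) = U (n + 1) :=
    Submodule.eq_of_le_of_finrank_le (hle n) (by
      rw [hmapdim]; exact (hN _).trans (hmono hn))
  refine ⟨heq.symm, fun u hu x => ?_⟩
  -- Every step, whatever its exponent of `A`, lands in B* U_n; cancelling the injective B* gives
  -- stability under powers of `A`.
  have h : formPullback (ρ B) (formPullback (ρ (A ^ x)) u) ∈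
      (U n).map (formPullback (ρ B)) := heq ▸ wordSpan_step hu x
  obtain ⟨u', hu', h'⟩ := h
  rwa [← formPullback_injective ρ B h']

/-- A coefficient of a word, as a function of one of its exponents, is nonzero near `+∞` unless
it vanishes identically. -/
theorem eventually_twistWord_ne_zero {ι : Type*} [Finite ι] (v : Module.Basis ι ℝ V)
    {ρ : Representation ℝ G V} {A B : G} {c : ι → ℝ} (hc : ∀ i, c i ≠ 0)
    (hA : ∀ i, ρ A (v i) = c i • v i)
    (habs : ∀ f g : Fin k → ι, |∏ i, c (f i)| = |∏ i, c (g i)| →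
      ∏ i, c (f i) = ∏ i, c (g i))
    (ω : MultilinearMap ℝ (fun _ : Fin k => V) ℝ) (y : Fin k → V) {n : ℕ} (l : Fin n → ℤ)
    (h : ω (fun i => ρ (twistWord A B l) (y i)) ≠ 0) (j : Fin n) :
    ∀ᶠ x : ℤ in atTop, ω (fun i => ρ (twistWord A B (Function.update l j x)) (y i)) ≠ 0 := by
  cases nonempty_fintype ι
  obtain ⟨X, Y, hXY⟩ := exists_twistWord_update A B l j
  -- Expanding the arguments in eigenvectors of `A` shows the frequencies to be the products of `k`
  -- eigenvalues.
  have hexp : ∀ x : ℤ, ω (fun i => ρ (twistWord A B (Function.update l j x)) (y i)) =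
      ∑ f : Fin k → ι, ((∏ i, v.repr (ρ Y (y i)) (f i)) * ω fun i => ρ X (v (f i))) *
        (∏ i, c (f i)) ^ x := by
    intro x
    have h1 : (fun i => ρ (twistWord A B (Function.update l j x)) (y i)) =
        fun i => ∑ p, (v.repr (ρ Y (y i)) p * c p ^ x) • ρ X (v p) := by
      funext i
      rw [hXY, map_mul, map_mul, Module.End.mul_apply, Module.End.mul_apply]
      conv_lhs => rw [← v.sum_repr (ρ Y (y i))]
      simp only [map_sum, map_smul, representation_zpow_apply_eigenvector ρ (hc _) (hA _),
        smul_smul]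
    rw [h1, MultilinearMap.map_sum]
    refine Finset.sum_congr rfl fun f _ => ?_
    rw [MultilinearMap.map_smul_univ, Finset.prod_mul_distrib, Finset.prod_zpow, smul_eq_mul]
    ring
  simp only [hexp]
  refine eventually_expSum_ne_zero _ _ (fun f => Finset.prod_ne_zero_iff.2 fun i _ => hc _)
    habs (l₀ := l j) ?_
  rw [← hexp, Function.update_eq_self]
  exact h

end Words

/-! ### Symplectic eigenbases and their root system. -/

/-- A basis of eigenvectors of `A`, adapted to a symplectic form: the eigenvalues come in pairs,
whose eigenvectors are dual to one another, and are otherwise multiplicatively independent in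
absolute value. -/
structure SymplecticEigenbasis {G V : Type*} [Group G] [AddCommGroup V] [Module ℝ V]
    (ρ : Representation ℝ G V) (Ω : LinearMap.BilinForm ℝ V) (A : G) (ι : Type*) where
  /-- the eigenvectors -/
  vec : Module.Basis ι ℝ V
  /-- the eigenvalues -/
  ev : ι → ℝ
  /-- the pairing of the eigenvalues -/
  inv : ι → ι
  inv_inv : ∀ i, inv (inv i) = i
  inv_ne : ∀ i, inv i ≠ i
  ev_ne_zero : ∀ i, ev i ≠ 0
  apply_vec : ∀ i, ρ A (vec i) = ev i • vec i
  form_eq_zero : ∀ i j, j ≠ inv i → Ω (vec i) (vec j) = 0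
  sum_eq_of_prod_eq : ∀ (k : ℕ) (f g : Fin k → ι),
    |∏ i, ev (f i)| = |∏ i, ev (g i)| → ∀ h : ι → ℝ, (∀ i, h (inv i) = -h i) →
      ∑ i, h (f i) = ∑ i, h (g i)
  prod_eq_of_abs_eq : ∀ (k : ℕ) (f g : Fin k → ι),
    |∏ i, ev (f i)| = |∏ i, ev (g i)| → ∏ i, ev (f i) = ∏ i, ev (g i)

namespace SymplecticEigenbasis

variable {G V ι : Type*} [Group G] [AddCommGroup V] [Module ℝ V]
  {ρ : Representation ℝ G V} {Ω : LinearMap.BilinForm ℝ V} {A : G}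

/-- Nonzero roots have one-dimensional root spaces. The test weight φ_a = 1_a - 1_{inv a} is odd,
equals 1 at a only, and is nonpositive elsewhere. Since φ_i is nonnegative at `i'`, comparing
weights puts `i` among `p`, `q`; the weight φ_{i'} then identifies the other index. -/
theorem mul_eq_mul_iff_of_ne (E : SymplecticEigenbasis ρ Ω A ι) {i i' p q : ι}
    (hi : i' ≠ E.inv i) (h : E.ev p * E.ev q = E.ev i * E.ev i') :
    p = i ∧ q = i' ∨ p = i' ∧ q = i := by
  classical
  have hodd : ∀ h : ι → ℝ, (∀ i, h (E.inv i) = -h i) → h p + h q = h i + h i' := by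
    intro φ hφ
    have := E.sum_eq_of_prod_eq 2 ![p, q] ![i, i'] (by simp [Fin.prod_univ_two, h]) φ hφ
    simpa [Fin.sum_univ_two] using this
  have hinj : ∀ a b, E.inv a = b ↔ a = E.inv b := fun a b =>
    ⟨fun h => by rw [← h, E.inv_inv], fun h => by rw [h, E.inv_inv]⟩
  set φ : ι → ι → ℝ := fun a x => (if x = a then 1 else 0) - if x = E.inv a then 1 else 0
    with hφ
  have hφodd : ∀ a x, φ a (E.inv x) = -φ a x := by
    intro a x
    simp only [hφ, hinj, E.inv_inv]
    ring
  have hself : ∀ a, φ a a = 1 := fun a => by simp [hφ, (E.inv_ne a).symm]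
  have hle : ∀ a x, x ≠ a → φ a x ≤ 0 := by
    intro a x hx
    simp only [hφ, if_neg hx]
    split_ifs <;> norm_num
  have hone : ∀ a b, φ a b = 1 → a = b := by
    intro a b hab
    by_contra hne
    linarith [hle a b (fun h => hne h.symm)]
  have hnn : 0 ≤ φ i i' := by
    simp only [hφ, if_neg hi]
    split_ifs <;> norm_num
  have h1 := hodd (φ i) (hφodd i)
  rw [hself] at h1
  by_cases hp : p = i
  · subst hp
    have h2 := hodd (φ i') (hφodd i')
    rw [hself] at h2
    exact Or.inl ⟨rfl, (hone i' q (by linarith)).symm⟩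
  · by_cases hq : q = i
    · subst hq
      have h2 := hodd (φ i') (hφodd i')
      rw [hself] at h2
      exact Or.inr ⟨(hone i' p (by linarith)).symm, rfl⟩
    · linarith [hle i p hp, hle i q hq]

/-- These are the Cartan elements: diagonal, with weights odd under `inv` and supported on one pair.
-/
theorem symProd_vec_inv_apply (E : SymplecticEigenbasis ρ Ω A ι) (hΩ : ∀ x, Ω x x = 0)
    [DecidableEq ι] (j i : ι) :
    symProd Ω (E.vec j) (E.vec (E.inv j)) (E.vec i) =
      ((if i = j then Ω (E.vec j) (E.vec (E.inv j)) else 0) -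
        if i = E.inv j then Ω (E.vec j) (E.vec (E.inv j)) else 0) • E.vec i := by
  rw [symProd_apply]
  have hskew : ∀ x y, Ω x y = -Ω y x := by
    intro x y
    have := hΩ (x + y)
    simp only [map_add, LinearMap.add_apply, hΩ] at this
    linarith
  by_cases h1 : i = j
  · subst h1
    simp [hΩ, (E.inv_ne i).symm]
  · by_cases h2 : i = E.inv j
    · subst h2
      rw [hΩ, hskew]
      simp [h1]
    · rw [E.form_eq_zero i j (fun h => h2 (by rw [h, E.inv_inv])),
        E.form_eq_zero i (E.inv j) (fun h => h1 (by rw [← E.inv_inv i, ← h, E.inv_inv]))]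
      simp [h1, h2]

end SymplecticEigenbasis

/-! ### Combinatorics of the nonzero entries of `B`. -/

/-- A relation on a set with a fixed-point-free involution which is symmetric under all signed
permutations, and such that neither it nor its square preserves a proper subset in the sense of
`hirr`, has enough edges to reach all pairs. -/
theorem symmetric_pattern_connected {ι : Type*} (inv : ι → ι)
    (inv_inv : ∀ i, inv (inv i) = i) (inv_ne : ∀ i, inv i ≠ i) (e : ι → ι → Prop)
    (hgen : ∀ i j i' j', j ≠ i → j ≠ inv i → j' ≠ i' → j' ≠ inv i' → e i j → e i' j')
    (hdiag : ∀ i j, e i i → e j j) (hanti : ∀ i j, e i (inv i) → e j (inv j))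
    (hirr : ∀ S S' : Set ι, (∀ i j, e i j → j ∈ S → i ∈ S') → (∀ i j, e i j → j ∈ S' → i ∈ S) →
      S = ∅ ∨ S = Set.univ) :
    (∀ i, ∃ j, e i j ∧ e i (inv j)) ∧
      ∀ i i', i' ≠ i → i' ≠ inv i → ∃ j, e i j ∧ e i' j := by
  have hinj : ∀ a b, inv a = b ↔ a = inv b := fun a b =>
    ⟨fun h => by rw [← h, inv_inv], fun h => by rw [h, inv_inv]⟩
  by_cases hex : ∃ i j, j ≠ i ∧ j ≠ inv i ∧ e i j
  · obtain ⟨i₀, j₀, h1, h2, h3⟩ := hex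
    have hg : ∀ i j, j ≠ i → j ≠ inv i → e i j := fun i j ha hb => hgen _ _ _ _ h1 h2 ha hb h3
    constructor
    · intro i
      obtain ⟨j, hj1, hj2⟩ : ∃ j, j ≠ i ∧ j ≠ inv i := by
        by_cases h : j₀ ≠ i ∧ j₀ ≠ inv i
        · exact ⟨j₀, h⟩
        · exact ⟨i₀, by grind, by grind⟩
      exact ⟨j, hg _ _ hj1 hj2, hg _ _ (by grind) (by grind)⟩
    · intro i i' hi hi'
      by_cases h : ∃ j, j ≠ i ∧ j ≠ inv i ∧ j ≠ i' ∧ j ≠ inv i'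
      · obtain ⟨j, a, b, c, d⟩ := h
        exact ⟨j, hg _ _ a b, hg _ _ c d⟩
      -- Now there are only two pairs. A diagonal or antidiagonal edge gives a common neighbour;
      -- without either, the relation exchanges the two pairs, which is excluded by `hirr` with a
      -- set and its complement.
      · by_cases hD : e i i
        · exact ⟨i, hD, hg _ _ hi.symm (by grind)⟩
        · by_cases hI : e i (inv i)
          · exact ⟨inv i, hI, hg _ _ (by grind) (by grind)⟩
          · exfalso
            have hD' : ∀ a, ¬ e a a := fun a ha => hD (hdiag a i ha)
            have hI' : ∀ a, ¬ e a (inv a) := fun a ha => hI (hanti a i ha)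
            rcases hirr {i, inv i} {i, inv i}ᶜ
              (by
                intro a b hab hb ha
                simp only [Set.mem_insert_iff, Set.mem_singleton_iff] at ha hb
                grind)
              (by
                intro a b hab hb
                simp only [Set.mem_compl_iff, Set.mem_insert_iff,
                  Set.mem_singleton_iff] at hb ⊢
                have h1 : ∀ c, c ≠ i → c ≠ inv i → c = i' ∨ c = inv i' := by
                  intro c hc hc'
                  by_contra! hcc
                  exact h ⟨c, hc, hc', hcc⟩
                by_contra! ha
                push Not at hb
                have hba : b = a ∨ b = inv a := by
                  rcases h1 a ha.1 ha.2 with rfl | rfl <;>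
                    rcases h1 b hb.1 hb.2 with rfl | rfl <;> simp [inv_inv]
                rcases hba with rfl | rfl
                · exact hD' _ hab
                · exact hI' _ hab) with hS | hS
            · exact (Set.insert_nonempty i {inv i}).ne_empty hS
            · have : i' ∈ ({i, inv i} : Set ι) := hS ▸ Set.mem_univ i'
              simp only [Set.mem_insert_iff, Set.mem_singleton_iff] at this
              grind
  · have hsub : ∀ a b, e a b → b = a ∨ b = inv a := by
      intro a b hab
      by_contra! h
      exact hex ⟨a, b, h.1, h.2, hab⟩
    -- Without generic edges every pair is preserved, so there is only one pair. A missing diagonal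
    -- edge would exchange the two singletons, and a missing antidiagonal edge would preserve each
    -- of them.
    have hpair : ∀ i i', i' = i ∨ i' = inv i := by
      intro i i'
      rcases hirr {i, inv i} {i, inv i} (by
          intro a b hab hb
          simp only [Set.mem_insert_iff, Set.mem_singleton_iff] at hb ⊢
          grind) (by
          intro a b hab hb
          simp only [Set.mem_insert_iff, Set.mem_singleton_iff] at hb ⊢
          grind) with hS | hS
      · exact absurd hS (Set.insert_nonempty i {inv i}).ne_empty
      · have : i' ∈ ({i, inv i} : Set ι) := hS ▸ Set.mem_univ i'
        simpa using this
    have hsing : ∀ i, ({i} : Set ι) = ∅ ∨ ({i} : Set ι) = Set.univ → False := by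
      rintro i (h | h)
      · exact (Set.singleton_nonempty i).ne_empty h
      · exact inv_ne i (by simpa using (h ▸ Set.mem_univ (inv i) : inv i ∈ ({i} : Set ι)))
    refine ⟨fun i => ⟨i, ?_, ?_⟩, fun i i' h h' => ((hpair i i').elim h h').elim⟩
    · by_contra hD
      refine hsing i (hirr {i} {inv i} ?_ ?_)
      · intro a b hab hb
        simp only [Set.mem_singleton_iff] at hb ⊢
        grind
      · intro a b hab hb
        simp only [Set.mem_singleton_iff] at hb ⊢
        grind
    · by_contra hI
      refine hsing i (hirr {i} {i} ?_ ?_) <;>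
      · intro a b hab hb
        simp only [Set.mem_singleton_iff] at hb ⊢
        grind

/-! ### Generating the symplectic Lie algebra, and transverse words. -/

namespace SymplecticEigenbasis

variable {G V ι : Type*} [Group G] [AddCommGroup V] [Module ℝ V]
  {ρ : Representation ℝ G V} {Ω : LinearMap.BilinForm ℝ V} {A B : G}

theorem conj_symProd {g : G} (hg : ∀ x y, Ω (ρ g x) (ρ g y) = Ω x y) (u w : V) :
    ρ g * symProd Ω u w * ρ g⁻¹ = symProd Ω (ρ g u) (ρ g w) := by
  rw [mul_symProd hg, mul_assoc, ← map_mul, mul_inv_cancel, map_one, mul_one]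

/-- A subspace invariant under conjugation by `A` contains the root components of its elements. -/
theorem sum_root_component_mem [Fintype ι] (E : SymplecticEigenbasis ρ Ω A ι)
    (hgA : ∀ x y, Ω (ρ A x) (ρ A y) = Ω x y) {𝔤 : Submodule ℝ (Module.End ℝ V)}
    (hA : ∀ X ∈ 𝔤, ρ A * X * ρ A⁻¹ ∈ 𝔤) {x y : V} (hxy : symProd Ω x y ∈ 𝔤) (r : ℝ) :
    ∑ p : ι × ι with E.ev p.1 * E.ev p.2 = r,
      (E.vec.repr x p.1 * E.vec.repr y p.2) • symProd Ω (E.vec p.1) (E.vec p.2) ∈ 𝔤 := by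
  refine sum_eigencomponent_mem
    (T := LinearMap.mulRight ℝ (ρ A⁻¹) ∘ₗ LinearMap.mulLeft ℝ (ρ A)) hA
    (fun p : ι × ι => (E.vec.repr x p.1 * E.vec.repr y p.2) •
      symProd Ω (E.vec p.1) (E.vec p.2))
    (fun p => E.ev p.1 * E.ev p.2) ?_ ?_ r
  · intro p
    rw [map_smul, LinearMap.comp_apply, LinearMap.mulLeft_apply, LinearMap.mulRight_apply,
      conj_symProd hgA, E.apply_vec, E.apply_vec, map_smul, map_smul, LinearMap.smul_apply,
      smul_smul, smul_smul, smul_smul]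
    congr 1
    ring
  · convert hxy
    conv_rhs => rw [← E.vec.sum_repr x, ← E.vec.sum_repr y]
    simp only [map_sum, map_smul, LinearMap.sum_apply, LinearMap.smul_apply]
    rw [Fintype.sum_prod_type, Finset.sum_comm]
    refine Finset.sum_congr rfl fun q _ => ?_
    rw [Finset.smul_sum]
    refine Finset.sum_congr rfl fun p _ => ?_
    rw [smul_smul, mul_comm]

/-- The matrix coefficient pattern of `B` in the eigenbasis. -/
def Edge (E : SymplecticEigenbasis ρ Ω A ι) (B : G) (i j : ι) : Prop :=
  E.vec.repr (ρ B (E.vec j)) i ≠ 0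

/-- A subspace of endomorphisms that is invariant under conjugation by `A` and `B` and contains
the Cartan subalgebra attached to `A` contains the whole symplectic Lie algebra. -/
theorem symProd_mem [Finite ι] (E : SymplecticEigenbasis ρ Ω A ι)
    (hgA : ∀ x y, Ω (ρ A x) (ρ A y) = Ω x y) (hgB : ∀ x y, Ω (ρ B x) (ρ B y) = Ω x y)
    {𝔤 : Submodule ℝ (Module.End ℝ V)}
    (hA : ∀ X ∈ 𝔤, ρ A * X * ρ A⁻¹ ∈ 𝔤) (hB : ∀ X ∈ 𝔤, ρ B * X * ρ B⁻¹ ∈ 𝔤)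
    (hcartan : ∀ j, symProd Ω (E.vec j) (E.vec (E.inv j)) ∈ 𝔤)
    (hlong : ∀ i, ∃ j, E.Edge B i j ∧ E.Edge B i (E.inv j))
    (hshort : ∀ i i', i' ≠ i → i' ≠ E.inv i → ∃ j, E.Edge B i j ∧ E.Edge B i' j) (u w : V) :
    symProd Ω u w ∈ 𝔤 := by
  classical
  cases nonempty_fintype ι
  -- Long roots: conjugating the Cartan element e_j ⬝ e_{inv j} by `B` gives Be_j ⬝ Be_{inv j},
  -- whose coefficient at e_i ⬝ e_i is the product of two nonzero entries of `B`.
  have hl : ∀ i, symProd Ω (E.vec i) (E.vec i) ∈ 𝔤 := by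
    intro i
    obtain ⟨j, h1, h2⟩ := hlong i
    have h := E.sum_root_component_mem hgA hA (conj_symProd hgB _ _ ▸ hB _ (hcartan j))
      (E.ev i * E.ev i)
    have hf : (Finset.univ.filter fun p : ι × ι => E.ev p.1 * E.ev p.2 = E.ev i * E.ev i) =
        {(i, i)} := by
      ext ⟨p, q⟩
      simp only [Finset.mem_filter, Finset.mem_univ, true_and, Finset.mem_singleton,
        Prod.mk.injEq]
      constructor
      · intro h
        rcases E.mul_eq_mul_iff_of_ne (E.inv_ne i).symm h with h | h <;> exact h
      · rintro ⟨rfl, rfl⟩; rfl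
    rw [hf, Finset.sum_singleton] at h
    exact (𝔤.smul_mem_iff (mul_ne_zero h1 h2)).1 h
  -- Short roots come from the long ones: Be_j ⬝ Be_j meets the root space of e_i ⬝ e_{i'} twice, in
  -- the orders (i, i') and (i', i), and the two contributions add up.
  have hs : ∀ i i', symProd Ω (E.vec i) (E.vec i') ∈ 𝔤 := by
    intro i i'
    by_cases hi : i' = i
    · rw [hi]; exact hl i
    by_cases hi' : i' = E.inv i
    · rw [hi']; exact hcartan i
    obtain ⟨j, h1, h2⟩ := hshort i i' hi hi'
    have h := E.sum_root_component_mem hgA hA (conj_symProd hgB _ _ ▸ hB _ (hl j))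
      (E.ev i * E.ev i')
    have hf : (Finset.univ.filter fun p : ι × ι => E.ev p.1 * E.ev p.2 = E.ev i * E.ev i') =
        {(i, i'), (i', i)} := by
      ext ⟨p, q⟩
      simp only [Finset.mem_filter, Finset.mem_univ, true_and, Finset.mem_singleton,
        Finset.mem_insert, Prod.mk.injEq]
      constructor
      · exact E.mul_eq_mul_iff_of_ne hi'
      · rintro (⟨rfl, rfl⟩ | ⟨rfl, rfl⟩)
        · rfl
        · exact mul_comm _ _
    rw [hf, Finset.sum_pair (by simp [Ne.symm hi]), symProd_comm Ω (E.vec i'),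
      ← add_smul] at h
    refine (𝔤.smul_mem_iff ?_).1 h
    rw [mul_comm (E.vec.repr _ i'), ← two_mul]
    exact mul_ne_zero two_ne_zero (mul_ne_zero h1 h2)
  rw [← E.vec.sum_repr u, ← E.vec.sum_repr w]
  simp only [map_sum, map_smul, LinearMap.sum_apply, LinearMap.smul_apply]
  exact 𝔤.sum_mem fun i _ => 𝔤.smul_mem _ (𝔤.sum_mem fun j _ => 𝔤.smul_mem _ (hs j i))

/-- If the pattern of `B` is rich enough, then for every long enough length there is a word that
moves a given subspace into a position transverse to a given one. -/
theorem exists_twistWord_ne_zero [Finite ι] [FiniteDimensional ℝ V]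
    (E : SymplecticEigenbasis ρ Ω A ι) (hΩ : ∀ x, Ω x x = 0)
    (hnd : ∀ u, u ≠ 0 → ∃ w, Ω u w ≠ 0)
    (hgA : ∀ x y, Ω (ρ A x) (ρ A y) = Ω x y) (hgB : ∀ x y, Ω (ρ B x) (ρ B y) = Ω x y)
    (hlong : ∀ i, ∃ j, E.Edge B i j ∧ E.Edge B i (E.inv j))
    (hshort : ∀ i i', i' ≠ i → i' ≠ E.inv i → ∃ j, E.Edge B i j ∧ E.Edge B i' j)
    {k : ℕ} {F F' : Submodule ℝ V} (x : Module.Basis (Fin k) ℝ F)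
    (b : Module.Basis (Fin k) ℝ (V ⧸ F')) :
    ∃ N, ∀ n, N ≤ n → ∃ l : Fin n → ℤ,
      quotientDetForm b (fun i => ρ (twistWord A B l) (x i)) ≠ 0 := by
  classical
  set ω := quotientDetForm b with hω
  obtain ⟨N, hN⟩ := wordSpan_stabilizes ρ A B ω
  set U := wordSpan ρ A B ω with hU
  refine ⟨N, fun n hn => ?_⟩
  -- All lengths `n ≥ N` are required at once, because B* carries U_n to U_{n+1}: conjugation by `B`
  -- shifts the length.
  let 𝔤 : Submodule ℝ (Module.End ℝ V) :=
    { carrier := {X | ∀ n, N ≤ n → ∀ u ∈ U n, formDerivation X u ∈ U n}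
      add_mem' := fun hX hY n hn u hu => by
        rw [map_add]; exact (U n).add_mem (hX n hn u hu) (hY n hn u hu)
      zero_mem' := fun n _ u _ => by rw [map_zero]; exact (U n).zero_mem
      smul_mem' := fun c X hX n hn u hu => by
        rw [map_smul]; exact (U n).smul_mem c (hX n hn u hu) }
  have hconj : ∀ (g : G) (X : Module.End ℝ V), ρ g * X = ρ g * X * ρ g⁻¹ * ρ g := by
    intro g X
    rw [mul_assoc _ (ρ g⁻¹), ← map_mul, inv_mul_cancel, map_one, mul_one]
  have hA1 : ∀ n, N ≤ n → ∀ u ∈ U n, formPullback (ρ A) u ∈ U n := fun n hn u hu => by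
    simpa using (hN n hn).2 u hu 1
  have hA2 : ∀ n, N ≤ n → ∀ u ∈ U n, formPullback (ρ A⁻¹) u ∈ U n := fun n hn u hu => by
    simpa using (hN n hn).2 u hu (-1)
  have h𝔤 : ∀ w, symProd Ω w w ∈ 𝔤 := by
    intro w
    refine E.symProd_mem (B := B) hgA hgB ?_ ?_ ?_ hlong hshort w w
    · intro X hX n hn u hu
      have h1 := hA2 n hn _ (hX n hn _ (hA1 n hn u hu))
      rwa [formDerivation_formPullback (hconj A X), formPullback_inv_self] at h1
    · intro X hX n hn u hu
      have h1 : formPullback (ρ B) u ∈ U (n + 1) := by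
        rw [(hN n hn).1]; exact ⟨u, hu, rfl⟩
      have h2 := hX (n + 1) (by omega) _ h1
      rw [formDerivation_formPullback (hconj B X), (hN n hn).1] at h2
      obtain ⟨u', hu', h3⟩ := h2
      rwa [← formPullback_injective ρ B h3]
    · intro j n hn u hu
      refine formDerivation_mem_of_diagonal E.vec E.apply_vec
        (E.symProd_vec_inv_apply hΩ j) ?_ (hA1 n hn) hu
      intro f g hfg
      refine E.sum_eq_of_prod_eq k f g (by rw [hfg]) (fun i =>
        (if i = j then Ω (E.vec j) (E.vec (E.inv j)) else 0) -
          if i = E.inv j then Ω (E.vec j) (E.vec (E.inv j)) else 0) fun i => ?_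
      have hinj : ∀ a b, E.inv a = b ↔ a = E.inv b := fun a b =>
        ⟨fun h => by rw [← h, E.inv_inv], fun h => by rw [h, E.inv_inv]⟩
      simp only [hinj, E.inv_inv]
      ring
  let M : Submonoid (Module.End ℝ V) :=
    { carrier := {g | IsUnit g ∧ ∀ u ∈ U n, formPullback g u ∈ U n}
      mul_mem' := fun {g h} hg hh => ⟨hg.1.mul hh.1, fun u hu => by
        rw [formPullback_mul]; exact hh.2 _ (hg.2 u hu)⟩
      one_mem' := ⟨isUnit_one, fun u hu => hu⟩ }
  -- `B ^ (n + 1)` is the word with all exponents zero, so C*ω lies in U_n. Hence `F` is to be made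
  -- transverse to C⁻¹(F').
  set C := ρ (B ^ (n + 1)) with hC
  have hinvC : ∀ (g : G) (y : V), ρ g⁻¹ (ρ g y) = y := by
    intro g y
    rw [← Module.End.mul_apply, ← map_mul, inv_mul_cancel, map_one, Module.End.one_apply]
  have hinvC' : ∀ (g : G) (y : V), ρ g (ρ g⁻¹ y) = y := by
    intro g y
    rw [← Module.End.mul_apply, ← map_mul, mul_inv_cancel, map_one, Module.End.one_apply]
  set D := ρ (B ^ (n + 1))⁻¹ with hD
  have hDinj : Function.Injective D :=
    Function.LeftInverse.injective (hinvC' _)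
  have hdim : Module.finrank ℝ F + Module.finrank ℝ (F'.map D) = Module.finrank ℝ V := by
    rw [← (Submodule.equivMapOfInjective D hDinj F').finrank_eq,
      ← F'.finrank_quotient_add_finrank, Module.finrank_eq_card_basis x,
      Module.finrank_eq_card_basis b]
  obtain ⟨g, hgM, hg⟩ := exists_mem_map_inf_eq_bot hΩ hnd (M := M)
    (fun w => ⟨IsNilpotent.isUnit_one_add ⟨2, by rw [pow_two, symProd_self_mul_self hΩ w]⟩,
      fun u hu => formPullback_one_add_mem (symProd_self_mul_self hΩ w) (h𝔤 w n hn) hu⟩)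
    F (F'.map D) hdim
  -- If all words vanished on the basis of `F`, so would U_n. But U_n contains the pullback of ω
  -- along `C * g`, and `C * g` moves `F` off `F'`.
  by_contra! hcon
  have hzero : ∀ u ∈ U n, u (fun i => (x i : V)) = 0 := by
    intro u hu
    induction hu using Submodule.span_induction with
    | mem u hu => obtain ⟨l, rfl⟩ := hu; exact hcon l
    | zero => rfl
    | add u u' _ _ h h' => rw [add_apply, h, h', add_zero]
    | smul c u _ h => rw [smul_apply, h, smul_zero]
  have hmem : formPullback C ω ∈ U n := Submodule.subset_span
    ⟨fun _ => 0, by simp only [twistWord_zero_exponents, hC]⟩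
  have h0 : quotientDetForm b (fun i => (C * g) (x i)) = 0 := hzero _ (hgM.2 _ hmem)
  have hinj : Function.Injective (C * g) :=
    (Function.LeftInverse.injective (hinvC _)).comp ((Module.End.isUnit_iff g).1 hgM.1).1
  refine (quotientDetForm_ne_zero_iff b x hinj).2 ?_ h0
  rw [Submodule.eq_bot_iff]
  rintro _ ⟨⟨y, hy, rfl⟩, hy'⟩
  have h1 : g y ∈ F.map g ⊓ F'.map D := ⟨⟨y, hy, rfl⟩, ⟨_, hy', hinvC _ _⟩⟩
  rw [hg, Submodule.mem_bot] at h1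
  rw [Module.End.mul_apply, h1, map_zero]

end SymplecticEigenbasis

/-! ### Weights depending only on net multiplicities. -/

section PairedWeights

variable {ι : Type*} [Fintype ι] [DecidableEq ι] {k : ℕ}

/-- The number of times a tuple takes a given value, as an integer. -/
def tupleCount (f : Fin k → ι) (i : ι) : ℤ := ∑ s, if f s = i then 1 else 0

theorem sum_comp_eq_sum_tupleCount (f : Fin k → ι) (h : ι → ℝ) :
    ∑ s, h (f s) = ∑ i, (tupleCount f i : ℝ) * h i := by
  simp only [tupleCount, Int.cast_sum, Finset.sum_mul]
  rw [Finset.sum_comm]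
  refine Finset.sum_congr rfl fun s _ => ?_
  simp

theorem prod_zpow_eq_zpow_sum {α K : Type*} [Field K] {a : K} (ha : a ≠ 0) (s : Finset α)
    (z : α → ℤ) : ∏ x ∈ s, a ^ z x = a ^ ∑ x ∈ s, z x := by
  classical
  induction s using Finset.induction_on with
  | empty => simp
  | insert x s hx ih => rw [Finset.prod_insert hx, Finset.sum_insert hx, ih, zpow_add₀ ha]

theorem prod_comp_eq_prod_tupleCount (f : Fin k → ι) {c : ι → ℝ} (hc : ∀ i, c i ≠ 0) :
    ∏ s, c (f s) = ∏ i, c i ^ tupleCount f i := by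
  simp only [tupleCount, ← prod_zpow_eq_zpow_sum (hc _)]
  rw [Finset.prod_comm]
  refine Finset.prod_congr rfl fun s _ => ?_
  rw [Finset.prod_eq_single (f s)]
  · simp
  · intro i _ hi
    simp [hi.symm]
  · simp

variable {inv : ι → ι} (hinv : Function.Involutive inv) {f g : Fin k → ι}
  (hfg : ∀ i, tupleCount f i - tupleCount f (inv i) = tupleCount g i - tupleCount g (inv i))
include hinv hfg

/-- By `hfg` the difference of the two counts is even under `inv`, while `h` is odd, so the
difference of the sums equals its own negative. -/
theorem sum_odd_eq_of_tupleCount_eq {h : ι → ℝ} (hh : ∀ i, h (inv i) = -h i) :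
    ∑ s, h (f s) = ∑ s, h (g s) := by
  rw [sum_comp_eq_sum_tupleCount, sum_comp_eq_sum_tupleCount, ← sub_eq_zero,
    ← Finset.sum_sub_distrib]
  refine self_eq_neg.1 ?_
  conv_lhs => rw [← Equiv.sum_comp hinv.toPerm]
  rw [← Finset.sum_neg_distrib]
  refine Finset.sum_congr rfl fun i _ => ?_
  have : ((tupleCount f i - tupleCount f (inv i) : ℤ) : ℝ) =
    (tupleCount g i - tupleCount g (inv i) : ℤ) := by rw [hfg]
  push_cast at this
  simp only [Function.Involutive.coe_toPerm, hh]
  linear_combination h i * this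

/-- The exponent in the quotient is the same at `i` and `inv i`, where the bases are inverse, so the
factors cancel in pairs. -/
theorem prod_eq_of_tupleCount_eq (hne : ∀ i, inv i ≠ i) {c : ι → ℝ} (hc : ∀ i, c i ≠ 0)
    (hcinv : ∀ i, c (inv i) = (c i)⁻¹) : ∏ s, c (f s) = ∏ s, c (g s) := by
  rw [prod_comp_eq_prod_tupleCount f hc, prod_comp_eq_prod_tupleCount g hc]
  have h0 : ∏ i, c i ^ tupleCount g i ≠ 0 :=
    Finset.prod_ne_zero_iff.2 fun i _ => zpow_ne_zero _ (hc i)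
  rw [← div_eq_one_iff_eq h0, ← Finset.prod_div_distrib]
  refine Finset.prod_involution (fun i _ => inv i) ?_ (fun i _ _ => hne i) (by simp)
    (fun i _ => hinv i)
  intro i _
  rw [← zpow_sub₀ (hc i), ← zpow_sub₀ (hc _), hcinv, inv_zpow', ← zpow_add₀ (hc i)]
  have := hfg i
  rw [show tupleCount f i - tupleCount g i + -(tupleCount f (inv i) - tupleCount g (inv i)) = 0
    by linarith, zpow_zero]

end PairedWeights

/-! ### Galois action on roots and multiplicative independence. -/

section GaloisAction

variable {F : Type*} [Field F] {P : F[X]}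

theorem add_inv_eq_add_inv_iff {K : Type*} [Field K] {x y : K} (hx : x ≠ 0) (hy : y ≠ 0) :
    x + x⁻¹ = y + y⁻¹ ↔ x = y ∨ x = y⁻¹ := by
  constructor
  · intro h
    have h1 : (x - y) * (x * y - 1) = 0 := by
      field_simp at h
      linear_combination h
    rcases mul_eq_zero.1 h1 with h2 | h2
    · exact Or.inl (sub_eq_zero.1 h2)
    · exact Or.inr (eq_inv_of_mul_eq_one_left (sub_eq_zero.1 h2))
  · rintro (rfl | rfl)
    · rfl
    · rw [inv_inv, add_comm]

theorem exists_perm_apply_eq {α : Type*} {a b a' b' : α} (hab : a ≠ b) (hab' : a' ≠ b') :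
    ∃ σ : Equiv.Perm α, σ a = a' ∧ σ b = b' := by
  classical
  refine ⟨Equiv.swap (Equiv.swap a a' b) b' * Equiv.swap a a', ?_, Equiv.swap_apply_left _ _⟩
  rw [Equiv.Perm.mul_apply, Equiv.swap_apply_left]
  refine Equiv.swap_apply_of_ne_of_ne (fun h => hab ?_) hab'
  exact (Equiv.swap a a').injective (by rw [Equiv.swap_apply_left, ← h])

theorem algEquiv_mem_rootSet (τ : P.SplittingField ≃ₐ[F] P.SplittingField)
    {μ : P.SplittingField} (hμ : μ ∈ P.rootSet P.SplittingField) :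
    τ μ ∈ P.rootSet P.SplittingField := by
  rw [mem_rootSet] at hμ ⊢
  refine ⟨hμ.1, ?_⟩
  rw [← AlgEquiv.coe_toAlgHom, aeval_algHom_apply, hμ.2, map_zero]

namespace HasLargestGaloisGroup

variable (hP : HasLargestGaloisGroup P) (h0 : (0 : P.SplittingField) ∉ P.rootSet P.SplittingField)
include hP h0

/-- An element of the Galois group acting on the traces as prescribed can be corrected to take
prescribed values at two roots with these traces. -/
theorem exists_algEquiv_of_traces {τ : P.SplittingField ≃ₐ[F] P.SplittingField}
    {x y x' y' : P.SplittingField} (hx : x ∈ P.rootSet P.SplittingField)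
    (hy : y ∈ P.rootSet P.SplittingField) (hx' : x' ∈ P.rootSet P.SplittingField)
    (hy' : y' ∈ P.rootSet P.SplittingField)
    (hτx : τ (x + x⁻¹) = x' + x'⁻¹) (hτy : τ (y + y⁻¹) = y' + y'⁻¹)
    (hxy : x' + x'⁻¹ = y' + y'⁻¹ → (τ x = x' ↔ τ y = y')) :
    ∃ g : P.SplittingField ≃ₐ[F] P.SplittingField, g x = x' ∧ g y = y' := by
  have hne : ∀ {μ}, μ ∈ P.rootSet P.SplittingField → μ ≠ 0 := fun hμ h => h0 (h ▸ hμ)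
  -- The correction inverts the pairs where `τ` picked the wrong root; `hxy` makes the two demands
  -- consistent when they concern the same pair.
  obtain ⟨g, hg⟩ := hP.indep_transpositions
    {r | (r = x' + x'⁻¹ ∧ τ x ≠ x') ∨ (r = y' + y'⁻¹ ∧ τ y ≠ y')} (by
      rintro r (⟨rfl, -⟩ | ⟨rfl, -⟩)
      · exact ⟨x', hx', rfl⟩
      · exact ⟨y', hy', rfl⟩)
  rw [map_add, map_inv₀] at hτx hτy
  have hgx := hg _ (algEquiv_mem_rootSet τ hx)
  have hgy := hg _ (algEquiv_mem_rootSet τ hy)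
  rw [hτx] at hgx
  rw [hτy] at hgy
  have hx1 := (add_inv_eq_add_inv_iff (hne (algEquiv_mem_rootSet τ hx)) (hne hx')).1 hτx
  have hy1 := (add_inv_eq_add_inv_iff (hne (algEquiv_mem_rootSet τ hy)) (hne hy')).1 hτy
  refine ⟨τ.trans g, ?_, ?_⟩
  · by_cases h : τ x = x'
    · rw [AlgEquiv.trans_apply, hgx.2, h]
      rintro (h' | h')
      · exact h'.2 h
      · exact h'.2 ((hxy h'.1).1 h)
    · rw [AlgEquiv.trans_apply, hgx.1 (Or.inl ⟨rfl, h⟩), hx1.resolve_left h, inv_inv]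
  · by_cases h : τ y = y'
    · rw [AlgEquiv.trans_apply, hgy.2, h]
      rintro (h' | h')
      · exact h'.2 ((hxy h'.1.symm).2 h)
      · exact h'.2 h
    · rw [AlgEquiv.trans_apply, hgy.1 (Or.inr ⟨rfl, h⟩), hy1.resolve_left h, inv_inv]

theorem exists_algEquiv_apply_eq {x x' : P.SplittingField}
    (hx : x ∈ P.rootSet P.SplittingField) (hx' : x' ∈ P.rootSet P.SplittingField) :
    ∃ g : P.SplittingField ≃ₐ[F] P.SplittingField, g x = x' := by
  classical
  obtain ⟨τ, hτ⟩ := hP.full_perm (Equiv.swap ⟨x + x⁻¹, x, hx, rfl⟩ ⟨x' + x'⁻¹, x', hx', rfl⟩)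
  have h := hτ ⟨x + x⁻¹, x, hx, rfl⟩
  rw [Equiv.swap_apply_left] at h
  obtain ⟨g, hg, -⟩ := hP.exists_algEquiv_of_traces h0 hx hx hx' hx' h h fun _ => Iff.rfl
  exact ⟨g, hg⟩

/-- Roots in different pairs have different traces, so a permutation of the traces moves both as
wanted, and the signs can be corrected independently. -/
theorem exists_algEquiv_apply_eq_pair {x y x' y' : P.SplittingField}
    (hx : x ∈ P.rootSet P.SplittingField) (hy : y ∈ P.rootSet P.SplittingField)
    (hx' : x' ∈ P.rootSet P.SplittingField) (hy' : y' ∈ P.rootSet P.SplittingField)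
    (hxy : y ≠ x) (hxy1 : y ≠ x⁻¹) (hxy' : y' ≠ x') (hxy1' : y' ≠ x'⁻¹) :
    ∃ g : P.SplittingField ≃ₐ[F] P.SplittingField, g x = x' ∧ g y = y' := by
  have hne : ∀ {μ}, μ ∈ P.rootSet P.SplittingField → μ ≠ 0 := fun hμ h => h0 (h ▸ hμ)
  have hr : x + x⁻¹ ≠ y + y⁻¹ := fun h =>
    ((add_inv_eq_add_inv_iff (hne hy) (hne hx)).1 h.symm).elim hxy hxy1
  have hr' : x' + x'⁻¹ ≠ y' + y'⁻¹ := fun h =>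
    ((add_inv_eq_add_inv_iff (hne hy') (hne hx')).1 h.symm).elim hxy' hxy1'
  let r : ∀ μ ∈ P.rootSet P.SplittingField, rootTraces P := fun μ hμ => ⟨μ + μ⁻¹, μ, hμ, rfl⟩
  obtain ⟨σ, hσ, hσ'⟩ := exists_perm_apply_eq (a := r x hx) (b := r y hy) (a' := r x' hx')
    (b' := r y' hy') (fun h => hr (congrArg Subtype.val h))
    (fun h => hr' (congrArg Subtype.val h))
  obtain ⟨τ, hτ⟩ := hP.full_perm σ
  have h1 := hτ (r x hx)
  have h2 := hτ (r y hy)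
  rw [hσ] at h1
  rw [hσ'] at h2
  exact hP.exists_algEquiv_of_traces h0 hx hy hx' hy' h1 h2 fun h => (hr' h).elim

/-- If all roots are real and different from `±1`, then the roots are multiplicatively independent
in absolute value, apart from the pairing of `μ` with `μ⁻¹`. -/
theorem tupleCount_eq_of_abs_prod_eq [DecidableEq (P.rootSet P.SplittingField)]
    (φ : P.SplittingField →+* ℝ) (hφ : ∀ μ ∈ P.rootSet P.SplittingField, |φ μ| ≠ 1)
    {inv : P.rootSet P.SplittingField → P.rootSet P.SplittingField}
    (hinv : ∀ i, (inv i : P.SplittingField) = (i : P.SplittingField)⁻¹) {k : ℕ}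
    {f g : Fin k → P.rootSet P.SplittingField}
    (hfg : |∏ s, φ (f s)| = |∏ s, φ (g s)|) (i : P.rootSet P.SplittingField) :
    tupleCount f i - tupleCount f (inv i) = tupleCount g i - tupleCount g (inv i) := by
  have hne : ∀ {μ}, μ ∈ P.rootSet P.SplittingField → μ ≠ 0 := fun hμ h => h0 (h ▸ hμ)
  have hi0 := hne i.2
  -- Squaring removes the absolute values and lifts the relation to the splitting field, where the
  -- Galois group acts.
  have hsq : (∏ s, (f s : P.SplittingField)) ^ 2 = (∏ s, (g s : P.SplittingField)) ^ 2 := by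
    apply φ.injective
    rw [map_pow, map_pow, map_prod, map_prod]
    exact sq_eq_sq_iff_abs_eq_abs _ _ |>.2 hfg
  obtain ⟨τ, hτ⟩ := hP.indep_transpositions {(i : P.SplittingField) + (i : P.SplittingField)⁻¹}
    (by rintro _ rfl; exact ⟨i, i.2, rfl⟩)
  have hinv_ne : inv i ≠ i := by
    intro h
    have h1 := congrArg Subtype.val h
    rw [hinv] at h1
    have h2 : (i : P.SplittingField) * i = 1 := by
      nth_rewrite 1 [← h1]
      exact inv_mul_cancel₀ hi0
    replace h2 : |φ (i : P.SplittingField)| * |φ (i : P.SplittingField)| = 1 := by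
      rw [← abs_mul, ← map_mul, h2, map_one, abs_one]
    have h3 : |φ (i : P.SplittingField)| = 1 := by
      nlinarith [abs_nonneg (φ (i : P.SplittingField))]
    exact hφ _ i.2 h3
  -- `τ` inverts only the pair of `i`, so it divides the product by i² to the power of the net
  -- multiplicity. Comparing `f` and `g` after squaring gives equal powers of i⁴, and |φ i| ≠ 1
  -- makes the exponents equal.
  have key : ∀ f : Fin k → P.rootSet P.SplittingField,
      τ (∏ s, (f s : P.SplittingField)) *
        ((i : P.SplittingField) ^ 2) ^ (tupleCount f i - tupleCount f (inv i)) =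
      ∏ s, (f s : P.SplittingField) := by
    intro f
    rw [tupleCount, tupleCount, ← Finset.sum_sub_distrib,
      ← prod_zpow_eq_zpow_sum (pow_ne_zero 2 hi0), map_prod, ← Finset.prod_mul_distrib]
    refine Finset.prod_congr rfl fun s _ => ?_
    by_cases h1 : f s = i
    · rw [h1, (hτ i i.2).1 rfl, if_pos rfl, if_neg hinv_ne.symm, sub_zero, zpow_one]
      field_simp
    · by_cases h2 : f s = inv i
      · rw [h2, (hτ _ (inv i).2).1 (by rw [hinv, inv_inv, add_comm]; rfl), if_neg hinv_ne,
          if_pos rfl, hinv, zero_sub, zpow_neg, zpow_one, inv_inv]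
        field_simp
      · rw [(hτ _ (f s).2).2, if_neg h1, if_neg h2, sub_zero, zpow_zero, mul_one]
        intro h
        rcases (add_inv_eq_add_inv_iff (hne (f s).2) hi0).1 h with h | h
        · exact h1 (Subtype.ext h)
        · exact h2 (Subtype.ext (by rw [h, hinv]))
  set a := tupleCount f i - tupleCount f (inv i)
  set b := tupleCount g i - tupleCount g (inv i)
  have hpow : ((i : P.SplittingField) ^ 4) ^ a = ((i : P.SplittingField) ^ 4) ^ b := by
    have hf := congrArg (· ^ 2) (key f)
    have hg := congrArg (· ^ 2) (key g)
    simp only [mul_pow, ← map_pow] at hf hg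
    rw [hsq] at hf
    have hne' : τ ((∏ s, (g s : P.SplittingField)) ^ 2) ≠ 0 := by
      rw [Ne, EmbeddingLike.map_eq_zero_iff]
      exact pow_ne_zero _ (Finset.prod_ne_zero_iff.2 fun s _ => hne (g s).2)
    have h1 := mul_left_cancel₀ hne' (hf.trans hg.symm)
    have h2 : ∀ z : ℤ, (((i : P.SplittingField) ^ 2) ^ z) ^ 2 =
        ((i : P.SplittingField) ^ 4) ^ z := by
      intro z
      rw [← zpow_natCast, ← zpow_natCast, ← zpow_natCast, ← zpow_mul, ← zpow_mul, ← zpow_mul]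
      congr 1
      push_cast
      ring
    rwa [h2, h2] at h1
  have hreal : (|φ i| ^ 4) ^ a = (|φ i| ^ 4) ^ b := by
    have := congrArg (fun x => |φ x|) hpow
    simpa [map_zpow₀, abs_zpow, map_pow, abs_pow] using this
  refine zpow_right_injective₀ (by have := (map_ne_zero φ).2 hi0; positivity) ?_ hreal
  intro h
  exact hφ _ i.2 ((pow_eq_one_iff_of_nonneg (abs_nonneg _) (by norm_num)).1 h)

end HasLargestGaloisGroup

end GaloisAction

/-! ### Subspaces invariant under a diagonalisable endomorphism. -/

section InvariantSubspaces

variable {V ι : Type*} [AddCommGroup V] [Module ℝ V] [Finite ι]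

/-- An endomorphism with simple real spectrum has finitely many invariant subspaces. -/
theorem finite_invtSubmodule (v : Module.Basis ι ℝ V) {T : Module.End ℝ V} {c : ι → ℝ}
    (hc : Function.Injective c) (hT : ∀ i, T (v i) = c i • v i) :
    {F : Submodule ℝ V | F ∈ T.invtSubmodule}.Finite := by
  classical
  cases nonempty_fintype ι
  -- With simple spectrum, the spectral projections put into `F` each eigenvector occurring in one
  -- of its elements; thus `F` is determined by a subset of `ι`.
  have hspan : ∀ F ∈ T.invtSubmodule, F = Submodule.span ℝ (v '' {i | v i ∈ F}) := by
    intro F hF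
    refine le_antisymm (fun x hx => ?_) (Submodule.span_le.2 ?_)
    · rw [← v.sum_repr x]
      refine Submodule.sum_mem _ fun i _ => ?_
      by_cases h : v.repr x i = 0
      · rw [h, zero_smul]; exact Submodule.zero_mem _
      · refine Submodule.smul_mem _ _ (Submodule.subset_span ⟨i, ?_, rfl⟩)
        have h1 := sum_eigencomponent_mem (T := T) (U := F) (fun u hu => hF hu) (fun j => v.repr x j • v j) c
          (fun j => by rw [map_smul, hT, smul_comm]) (by rwa [v.sum_repr]) (c i)
        have h2 : (Finset.univ.filter fun j => c j = c i) = {i} := by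
          ext j; simp [hc.eq_iff]
        rw [h2, Finset.sum_singleton] at h1
        exact (F.smul_mem_iff h).1 h1
    · rintro _ ⟨i, hi, rfl⟩
      exact hi
  refine Set.Finite.of_injOn (f := fun F => {i | v i ∈ F}) (t := Set.univ)
    (fun _ _ => Set.mem_univ _) ?_ Set.finite_univ
  intro F hF F' hF' h
  rw [hspan F hF, hspan F' hF']
  exact congrArg (fun S => Submodule.span ℝ (v '' S)) h

/-- If no proper subspace is invariant under both `A` and `B ^ 2`, then `B` does
not exchange two proper subspaces spanned by eigenvectors of `A`. -/
theorem eq_empty_or_univ_of_irreducible (v : Module.Basis ι ℝ V) {A B : Module.End ℝ V}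
    {c : ι → ℝ} (hA : ∀ i, A (v i) = c i • v i)
    (hirr : ¬ ∃ F : Submodule ℝ V, F ≠ ⊥ ∧ F ≠ ⊤ ∧ F ∈ A.invtSubmodule ∧
      F ∈ (B ^ 2).invtSubmodule) (S S' : Set ι)
    (hS : ∀ i j, v.repr (B (v j)) i ≠ 0 → j ∈ S → i ∈ S')
    (hS' : ∀ i j, v.repr (B (v j)) i ≠ 0 → j ∈ S' → i ∈ S) : S = ∅ ∨ S = Set.univ := by
  cases nonempty_fintype ι
  by_contra! hne
  obtain ⟨⟨i, hi⟩, hne⟩ := hne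
  obtain ⟨i', hi'⟩ := (Set.ne_univ_iff_exists_notMem S).1 hne
  have hmap : ∀ S S' : Set ι, (∀ i j, v.repr (B (v j)) i ≠ 0 → j ∈ S → i ∈ S') →
      ∀ x ∈ Submodule.span ℝ (v '' S), B x ∈ Submodule.span ℝ (v '' S') := by
    intro S S' h x hx
    refine (Submodule.span_le (p := (Submodule.span ℝ (v '' S')).comap B)).2 ?_ hx
    rintro _ ⟨j, hj, rfl⟩
    simp only [Submodule.comap_coe, Set.mem_preimage, SetLike.mem_coe]
    rw [← v.sum_repr (B (v j))]
    refine Submodule.sum_mem _ fun p _ => ?_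
    by_cases hp : v.repr (B (v j)) p = 0
    · rw [hp, zero_smul]; exact Submodule.zero_mem _
    · exact Submodule.smul_mem _ _ (Submodule.subset_span ⟨p, h p j hp hj, rfl⟩)
  refine hirr ⟨Submodule.span ℝ (v '' S), ?_, ?_, ?_, ?_⟩
  · intro h
    have : v i ∈ Submodule.span ℝ (v '' S) := Submodule.subset_span ⟨i, hi, rfl⟩
    rw [h, Submodule.mem_bot] at this
    exact v.ne_zero i this
  · intro h
    exact v.linearIndependent.notMem_span_image hi' (h ▸ Submodule.mem_top)
  · refine Submodule.span_le.2 ?_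
    rintro _ ⟨j, hj, rfl⟩
    simp only [Submodule.comap_coe, Set.mem_preimage, SetLike.mem_coe, hA]
    exact Submodule.smul_mem _ _ (Submodule.subset_span ⟨j, hj, rfl⟩)
  · intro x hx
    simp only [Submodule.mem_comap, pow_two, Module.End.mul_apply]
    exact hmap S' S hS' _ (hmap S S' hS _ hx)

end InvariantSubspaces

/-! ### One word for all pairs of invariant subspaces. -/

namespace SymplecticEigenbasis

variable {G V ι : Type*} [Group G] [AddCommGroup V] [Module ℝ V]
  {ρ : Representation ℝ G V} {Ω : LinearMap.BilinForm ℝ V} {A B : G}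

/-- Some length admits words with arbitrarily large exponents which are transverse for all pairs
of complementary `A`-invariant subspaces. -/
theorem exists_transverse_twistWord [Finite ι] [FiniteDimensional ℝ V]
    (E : SymplecticEigenbasis ρ Ω A ι) (hev : Function.Injective E.ev) (hΩ : ∀ x, Ω x x = 0)
    (hnd : ∀ u, u ≠ 0 → ∃ w, Ω u w ≠ 0)
    (hgA : ∀ x y, Ω (ρ A x) (ρ A y) = Ω x y) (hgB : ∀ x y, Ω (ρ B x) (ρ B y) = Ω x y)
    (hlong : ∀ i, ∃ j, E.Edge B i j ∧ E.Edge B i (E.inv j))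
    (hshort : ∀ i i', i' ≠ i → i' ≠ E.inv i → ∃ j, E.Edge B i j ∧ E.Edge B i' j) :
    ∃ n : ℕ, ∀ L : ℤ, ∃ l : Fin n → ℤ, (∀ i, L < l i) ∧
      ∀ F ∈ Module.End.invtSubmodule (ρ A), ∀ F' ∈ Module.End.invtSubmodule (ρ A),
        Module.finrank ℝ F + Module.finrank ℝ F' = Module.finrank ℝ V →
          F.map (ρ (twistWord A B l)) ⊓ F' = ⊥ := by
  let 𝓘 : Set (Submodule ℝ V) := {F | F ∈ Module.End.invtSubmodule (ρ A)}
  have : Finite 𝓘 := finite_invtSubmodule E.vec hev E.apply_vec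
  let I := {p : 𝓘 × 𝓘 //
    Module.finrank ℝ p.1.1 + Module.finrank ℝ p.2.1 = Module.finrank ℝ V}
  let x : ∀ p : I, Module.Basis (Fin (Module.finrank ℝ p.1.1.1)) ℝ p.1.1.1 :=
    fun p => Module.finBasis ℝ _
  let b : ∀ p : I, Module.Basis (Fin (Module.finrank ℝ p.1.1.1)) ℝ (V ⧸ p.1.2.1) :=
    fun p => Module.finBasisOfFinrankEq ℝ _ (by
      have h1 := p.2
      have h2 := p.1.2.1.finrank_quotient_add_finrank
      omega)
  choose N hN using fun p : I =>
    E.exists_twistWord_ne_zero (B := B) hΩ hnd hgA hgB hlong hshort (x p) (b p)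
  -- Each pair admits every length from its own threshold on, so finitely many pairs share a length.
  obtain ⟨n, hn⟩ := Set.finite_range N |>.bddAbove
  refine ⟨n, fun L => ?_⟩
  obtain ⟨l, hl, hl'⟩ := exists_common_tuple
    (fun (p : I) (l : Fin n → ℤ) =>
      quotientDetForm (b p) (fun i => ρ (twistWord A B l) (x p i)) ≠ 0)
    (fun p l hpl j => eventually_twistWord_ne_zero E.vec E.ev_ne_zero E.apply_vec
      (E.prod_eq_of_abs_eq _) _ _ l hpl j)
    (fun p => hN p n (hn ⟨p, rfl⟩)) L
  refine ⟨l, hl, fun F hF F' hF' hdim => ?_⟩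
  refine (quotientDetForm_ne_zero_iff _ _ ?_).1 (hl' ⟨(⟨F, hF⟩, ⟨F', hF'⟩), hdim⟩)
  refine Function.LeftInverse.injective (g := ρ (twistWord A B l)⁻¹) fun y => ?_
  rw [← Module.End.mul_apply, ← map_mul, inv_mul_cancel, map_one, Module.End.one_apply]

end SymplecticEigenbasis

/-! ### Integer matrices over varying fields. -/

section IntegerMatrices

open Matrix

variable {n : Type*} [Fintype n] {K L : Type*} [Field K] [Field L]

/-- The action of an integer matrix on vectors over a field. -/
def intMulVec (M : Matrix n n ℤ) (x : n → K) : n → K := (M.map (Int.castRingHom K)).mulVec x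

/-- The bilinear form given by an integer matrix over a field. -/
def intForm (J : Matrix n n ℤ) (x y : n → K) : K := x ⬝ᵥ intMulVec J y

theorem map_comp_intMulVec (ψ : K →+* L) (M : Matrix n n ℤ) (x : n → K) :
    ψ ∘ intMulVec M x = intMulVec M (ψ ∘ x) := by
  funext i
  rw [Function.comp_apply, intMulVec, RingHom.map_mulVec, Matrix.map_map, intMulVec]
  congr 2
  ext i
  simp

/-- The form has integer coefficients, so real embeddings and Galois automorphisms both respect it;
this carries nonvanishing of entries of `B` between the splitting field and ℝ. -/
theorem map_intForm (ψ : K →+* L) (J : Matrix n n ℤ) (x y : n → K) :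
    ψ (intForm J x y) = intForm J (ψ ∘ x) (ψ ∘ y) := by
  rw [intForm, RingHom.map_dotProduct, map_comp_intMulVec, intForm]

theorem intForm_intMulVec {J C : Matrix n n ℤ} (h : C.transpose * J * C = J) (x y : n → K) :
    intForm J (intMulVec C x) (intMulVec C y) = intForm J x y := by
  have h' := congrArg (fun M : Matrix n n ℤ => M.map (Int.castRingHom K)) h
  simp only [Matrix.map_mul, Matrix.transpose_map] at h'
  simp only [intForm, intMulVec]
  rw [dotProduct_mulVec, vecMul_mulVec, dotProduct_mulVec, vecMul_vecMul, h', dotProduct_mulVec]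

theorem intForm_transpose (J : Matrix n n ℤ) (x y : n → K) :
    intForm J.transpose x y = intForm J y x := by
  rw [intForm, intMulVec, Matrix.transpose_map, mulVec_transpose, dotProduct_comm,
    ← dotProduct_mulVec, intForm, intMulVec]

theorem intForm_self {J : Matrix n n ℤ} (hJ : J.transpose = -J) [CharZero K] (x : n → K) :
    intForm J x x = 0 := by
  have h := intForm_transpose J x x
  have hneg : (-J).map (Int.castRingHom K) = -J.map (Int.castRingHom K) := by
    ext i j; simp
  rw [hJ, intForm, intMulVec, hneg, neg_mulVec, dotProduct_neg] at h
  exact self_eq_neg.1 h.symm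

variable [DecidableEq n]

theorem intMulVec_ne_zero [CharZero K] {J : Matrix n n ℤ} (hJ : J.det ≠ 0) {x : n → K}
    (hx : x ≠ 0) : intMulVec J x ≠ 0 := by
  intro h
  have h1 : (J.map (Int.castRingHom K)).det = 0 :=
    Matrix.exists_mulVec_eq_zero_iff.1 ⟨x, hx, h⟩
  have h2 := RingHom.map_det (Int.castRingHom K) J
  rw [RingHom.mapMatrix_apply, h1] at h2
  exact hJ (by simpa using h2)

theorem exists_intForm_ne_zero [CharZero K] {J : Matrix n n ℤ} (hJ : J.det ≠ 0)
    {x : n → K} (hx : x ≠ 0) : ∃ y, intForm J x y ≠ 0 := by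
  by_contra! h
  rw [← Matrix.det_transpose] at hJ
  refine intMulVec_ne_zero hJ hx (dotProduct_eq_zero _ fun y => ?_)
  rw [dotProduct_comm]
  exact (intForm_transpose J y x).trans (h y)

theorem eval₂_map_charpoly_eq_zero_iff (f : ℚ →+* K) (M : Matrix n n ℤ) (μ : K) :
    (M.charpoly.map (Int.castRingHom ℚ)).eval₂ f μ = 0 ↔
      ∃ x : n → K, x ≠ 0 ∧ intMulVec M x = μ • x := by
  rw [eval₂_map, eval₂_eq_eval_map,
    RingHom.ext_int (f.comp (Int.castRingHom ℚ)) (Int.castRingHom K),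
    ← Matrix.charpoly_map, Matrix.eval_charpoly, ← Matrix.exists_mulVec_eq_zero_iff]
  refine exists_congr fun x => and_congr_right fun _ => ?_
  rw [sub_mulVec, sub_eq_zero, eq_comm, intMulVec]
  simp [Matrix.scalar_apply, ← Matrix.smul_one_eq_diagonal, smul_mulVec]

/-- The eigenvalues of a symplectic matrix come in pairs `μ`, `μ⁻¹`. -/
theorem eval₂_inv_charpoly_eq_zero (f : ℚ →+* K) {J M : Matrix n n ℤ} (hJ : J.det ≠ 0)
    (hM : M.transpose * J * M = J) {μ : K} (hμ0 : μ ≠ 0)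
    (hμ : (M.charpoly.map (Int.castRingHom ℚ)).eval₂ f μ = 0) :
    (M.charpoly.map (Int.castRingHom ℚ)).eval₂ f μ⁻¹ = 0 := by
  have : CharZero K := charZero_of_injective_ringHom f.injective
  obtain ⟨x, hx, hMx⟩ := (eval₂_map_charpoly_eq_zero_iff f M μ).1 hμ
  rw [← Matrix.charpoly_transpose, eval₂_map_charpoly_eq_zero_iff]
  -- From MᵀJM = J and Mx = μx one gets Mᵀ(Jx) = μ⁻¹Jx, and Mᵀ has the same characteristic
  -- polynomial as `M`.
  refine ⟨intMulVec J x, intMulVec_ne_zero hJ hx, ?_⟩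
  have h' := congrArg (fun N : Matrix n n ℤ => (N.map (Int.castRingHom K)).mulVec x) hM
  simp only [Matrix.map_mul, ← Matrix.mulVec_mulVec] at h'
  change intMulVec M.transpose (intMulVec J (intMulVec M x)) = intMulVec J x at h'
  rw [hMx] at h'
  have hs : ∀ (N : Matrix n n ℤ) (c : K) (y : n → K), intMulVec N (c • y) = c • intMulVec N y :=
    fun N c y => mulVec_smul _ _ _
  rw [hs, hs] at h'
  rw [eq_inv_smul_iff₀ hμ0, h']

end IntegerMatrices

/-! ### The real representation. -/

section RealRepresentation

variable {d : ℕ}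

/-- The action of integer matrices on `ℝ^{2d}`, as a representation. -/
noncomputable def realRepresentation (d : ℕ) :
    Representation ℝ (Matrix.SpecialLinearGroup (Fin (2 * d)) ℤ) (Fin (2 * d) → ℝ) where
  toFun := realAction
  map_one' := by
    simp [realAction, Module.End.one_eq_id]
  map_mul' A B := by
    change Matrix.toLin' ((A.1 * B.1).map _) = _
    rw [Matrix.map_mul, Matrix.toLin'_mul]
    rfl

theorem realRepresentation_apply (A : Matrix.SpecialLinearGroup (Fin (2 * d)) ℤ)
    (x : Fin (2 * d) → ℝ) : realRepresentation d A x = intMulVec A.1 x := rfl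

theorem realForm_apply (J : Matrix (Fin (2 * d)) (Fin (2 * d)) ℤ) (x y : Fin (2 * d) → ℝ) :
    realForm J x y = intForm J x y := Matrix.toBilin'_apply' _ x y

end RealRepresentation

/-! ### Roots in the splitting field. -/

section SplittingRoots

variable {F : Type*} [Field F]

/-- The roots of a polynomial in its splitting field. -/
abbrev splittingRoots (P : F[X]) : Set P.SplittingField := P.rootSet P.SplittingField

theorem mem_splittingRoots {P : F[X]} (hP : P ≠ 0) {μ : P.SplittingField} :
    μ ∈ splittingRoots P ↔ P.eval₂ (algebraMap F P.SplittingField) μ = 0 := by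
  rw [splittingRoots, mem_rootSet, aeval_def, and_iff_right hP]

theorem natCard_splittingRoots {P : F[X]} (hP : P.Separable) :
    Nat.card (splittingRoots P) = P.natDegree := by
  rw [Nat.card_eq_fintype_card, card_rootSet_eq_natDegree hP (SplittingField.splits _)]

theorem ne_algebraMap_of_mem_splittingRoots {P : F[X]} (hP : Irreducible P)
    (hdeg : P.natDegree ≠ 1) {μ : P.SplittingField} (hμ : μ ∈ splittingRoots P) (q : F) :
    μ ≠ algebraMap F _ q := by
  rintro rfl
  rw [mem_splittingRoots hP.ne_zero, eval₂_at_apply, map_eq_zero] at hμ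
  exact hdeg (natDegree_eq_of_degree_eq_some (degree_eq_one_of_irreducible_of_root hP hμ))

theorem nonempty_splittingField_ringHom {L : Type*} [Field L] {P : F[X]} (f : F →+* L)
    (h : (P.map f).Splits) : Nonempty (P.SplittingField →+* L) :=
  let _ := f.toAlgebra
  ⟨(SplittingField.lift P h).toRingHom⟩

end SplittingRoots

/-! ### The eigenbasis of a Galois-pinching matrix. -/

namespace IsGaloisPinching

variable {d : ℕ} {A : Matrix.SpecialLinearGroup (Fin (2 * d)) ℤ}

theorem natDegree_ratCharpoly (A : Matrix.SpecialLinearGroup (Fin (2 * d)) ℤ) :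
    (ratCharpoly A).natDegree = 2 * d := by
  rw [ratCharpoly, (Matrix.charpoly_monic A.1).natDegree_map, Matrix.charpoly_natDegree_eq_dim,
    Fintype.card_fin]

/-- The splitting field of the characteristic polynomial has a real embedding. -/
theorem nonempty_real_embedding (hA : IsGaloisPinching A) :
    Nonempty ((ratCharpoly A).SplittingField →+* ℝ) := by
  refine nonempty_splittingField_ringHom (algebraMap ℚ ℝ) ?_
  refine Splits.of_splits_map (algebraMap ℝ ℂ) (IsAlgClosed.splits _) fun z hz => ?_
  have h1 : aeval z (ratCharpoly A) = 0 := by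
    have := (mem_roots'.1 hz).2
    rw [map_map, ← IsScalarTower.algebraMap_eq, IsRoot, eval_map_algebraMap] at this
    exact this
  exact ⟨z.re, Complex.ext rfl (hA.real_roots z h1).symm⟩

/-- An irreducible polynomial of even degree has no rational root. -/
theorem ne_zero_one_neg_one (hA : IsGaloisPinching A) {μ : (ratCharpoly A).SplittingField}
    (hμ : μ ∈ splittingRoots (ratCharpoly A)) :
    μ ≠ 0 ∧ μ ≠ 1 ∧ μ ≠ -1 := by
  have h := ne_algebraMap_of_mem_splittingRoots hA.irreducible
    (by rw [natDegree_ratCharpoly]; omega) hμ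
  exact ⟨by simpa using h 0, by simpa using h 1, by simpa using h (-1)⟩

theorem abs_ne_one (hA : IsGaloisPinching A) (φ : (ratCharpoly A).SplittingField →+* ℝ)
    {μ : (ratCharpoly A).SplittingField} (hμ : μ ∈ splittingRoots (ratCharpoly A)) :
    |φ μ| ≠ 1 := by
  intro h
  rcases abs_eq_abs.1 (h.trans abs_one.symm) with h | h
  · exact (hA.ne_zero_one_neg_one hμ).2.1 (φ.injective (by rw [h, map_one]))
  · exact (hA.ne_zero_one_neg_one hμ).2.2 (φ.injective (by rw [h, map_neg, map_one]))

/-- The eigenvalues are stable under `μ ↦ μ⁻¹`. -/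
theorem inv_mem (hA : IsGaloisPinching A) {J : Matrix (Fin (2 * d)) (Fin (2 * d)) ℤ}
    (hJ : J.det ≠ 0) (hAJ : A ∈ SpInt J) {μ : (ratCharpoly A).SplittingField}
    (hμ : μ ∈ splittingRoots (ratCharpoly A)) : μ⁻¹ ∈ splittingRoots (ratCharpoly A) := by
  have h0 := (hA.ne_zero_one_neg_one hμ).1
  rw [mem_splittingRoots hA.irreducible.ne_zero] at hμ ⊢
  exact eval₂_inv_charpoly_eq_zero _ hJ hAJ h0 hμ

theorem exists_eigenvector (hA : IsGaloisPinching A) (μ : splittingRoots (ratCharpoly A)) :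
    ∃ x : Fin (2 * d) → (ratCharpoly A).SplittingField, x ≠ 0 ∧
      intMulVec A.1 x = (μ : (ratCharpoly A).SplittingField) • x :=
  (eval₂_map_charpoly_eq_zero_iff _ A.1 _).1
    ((mem_splittingRoots hA.irreducible.ne_zero).1 μ.2)

theorem intMulVec_comp_eigenvector {K L : Type*} [Field K] [Field L] (ψ : K →+* L)
    {n : Type*} [Fintype n] {M : Matrix n n ℤ} {x : n → K} {μ : K}
    (h : intMulVec M x = μ • x) : intMulVec M (ψ ∘ x) = ψ μ • (ψ ∘ x) := by
  rw [← map_comp_intMulVec, h]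
  funext i
  simp

open Classical in
/-- The symplectic eigenbasis of a Galois-pinching matrix attached to a real embedding of the
splitting field and to a choice of eigenvectors over the splitting field. -/
noncomputable def eigenbasis (hA : IsGaloisPinching A)
    {J : Matrix (Fin (2 * d)) (Fin (2 * d)) ℤ} (hJ : J.det ≠ 0) (hAJ : A ∈ SpInt J)
    (φ : (ratCharpoly A).SplittingField →+* ℝ)
    {u : splittingRoots (ratCharpoly A) → Fin (2 * d) → (ratCharpoly A).SplittingField}
    (hu0 : ∀ μ, u μ ≠ 0)
    (hu : ∀ μ, intMulVec A.1 (u μ) = (μ : (ratCharpoly A).SplittingField) • u μ) :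
    SymplecticEigenbasis (realRepresentation d) (realForm J) A
      (splittingRoots (ratCharpoly A)) :=
  have heig : ∀ μ, realRepresentation d A (φ ∘ u μ) = φ μ • (φ ∘ u μ) := fun μ =>
    intMulVec_comp_eigenvector φ (hu μ)
  have hinj : Function.Injective
      fun μ : splittingRoots (ratCharpoly A) => φ (μ : (ratCharpoly A).SplittingField) :=
    φ.injective.comp Subtype.val_injective
  have hne : ∀ μ, φ ∘ u μ ≠ 0 := fun μ h => hu0 μ (funext fun i => φ.injective (by
    rw [Pi.zero_apply, map_zero]; exact congrFun h i))
  have hli : LinearIndependent ℝ fun μ => φ ∘ u μ :=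
    Module.End.eigenvectors_linearIndependent' (realRepresentation d A) _ hinj _ fun μ =>
      ⟨Module.End.mem_eigenspace_iff.2 (heig μ), hne μ⟩
  have hcard : Nat.card (splittingRoots (ratCharpoly A)) = 2 * d := by
    rw [natCard_splittingRoots hA.irreducible.separable, natDegree_ratCharpoly]
  let vec : Module.Basis (splittingRoots (ratCharpoly A)) ℝ (Fin (2 * d) → ℝ) :=
    Module.Basis.mk hli (hli.span_eq_top_of_card_eq_finrank' (by
      rw [← Nat.card_eq_fintype_card, hcard, Module.finrank_fin_fun])).ge
  have hvec : ∀ μ, vec μ = φ ∘ u μ := fun μ => Module.Basis.mk_apply _ _ μ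
  let inv : splittingRoots (ratCharpoly A) → splittingRoots (ratCharpoly A) := fun μ =>
    ⟨(μ : (ratCharpoly A).SplittingField)⁻¹, hA.inv_mem hJ hAJ μ.2⟩
  have hinv : Function.Involutive inv := fun μ => Subtype.ext (inv_inv _)
  have h0 : (0 : (ratCharpoly A).SplittingField) ∉ splittingRoots (ratCharpoly A) := fun h =>
    (hA.ne_zero_one_neg_one h).1 rfl
  have hev : ∀ μ : splittingRoots (ratCharpoly A), φ μ ≠ 0 := fun μ =>
    (map_ne_zero φ).2 (hA.ne_zero_one_neg_one μ.2).1
  have hinv_ne : ∀ μ, inv μ ≠ μ := fun μ h => by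
    have h1 : (μ : (ratCharpoly A).SplittingField)⁻¹ = μ := congrArg Subtype.val h
    have h2 := (hA.ne_zero_one_neg_one μ.2)
    have h3 : (μ : (ratCharpoly A).SplittingField) * μ = 1 := by
      nth_rewrite 1 [← h1]
      exact inv_mul_cancel₀ h2.1
    exact (mul_self_eq_one_iff.1 h3).elim h2.2.1 h2.2.2
  have hcount : ∀ (k : ℕ) (f g : Fin k → splittingRoots (ratCharpoly A)),
      |∏ i, φ (f i)| = |∏ i, φ (g i)| → _ := fun k f g h =>
    HasLargestGaloisGroup.tupleCount_eq_of_abs_prod_eq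
      hA.largest_galois h0 φ (fun μ hμ => hA.abs_ne_one φ hμ) (inv := inv) (fun _ => rfl) h
  { vec := vec
    ev := fun μ => φ μ
    inv := inv
    inv_inv := hinv
    inv_ne := hinv_ne
    ev_ne_zero := hev
    apply_vec := fun μ => by rw [hvec, heig]
    form_eq_zero := fun μ ν h => by
      -- Invariance of the form multiplies its value by μν, so a nonzero value forces μν = 1.
      by_contra hform
      have h1 : realForm J (realRepresentation d A (vec μ)) (realRepresentation d A (vec ν)) =
          realForm J (vec μ) (vec ν) := by
        simp only [realForm_apply, realRepresentation_apply]
        exact intForm_intMulVec hAJ _ _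
      rw [hvec, hvec] at hform
      rw [hvec, hvec, heig, heig, map_smul, map_smul, LinearMap.smul_apply, smul_eq_mul,
        smul_eq_mul, ← mul_assoc, mul_eq_right₀ hform, ← map_mul, ← map_one φ] at h1
      exact h (Subtype.ext (eq_inv_of_mul_eq_one_left (φ.injective h1)))
    sum_eq_of_prod_eq := fun k f g h φ hφ => sum_odd_eq_of_tupleCount_eq hinv (hcount k f g h) hφ
    prod_eq_of_abs_eq := fun k f g h => prod_eq_of_tupleCount_eq hinv (hcount k f g h) hinv_ne
      hev fun μ => map_inv₀ φ _ }

end IsGaloisPinching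

/-! ### Galois invariance of the entries of `B`. -/

namespace IsGaloisPinching

variable {d : ℕ} {A B : Matrix.SpecialLinearGroup (Fin (2 * d)) ℤ} (hA : IsGaloisPinching A)
  {J : Matrix (Fin (2 * d)) (Fin (2 * d)) ℤ} (hJ : J.det ≠ 0) (hAJ : A ∈ SpInt J)
  (φ : (ratCharpoly A).SplittingField →+* ℝ)
  {u : splittingRoots (ratCharpoly A) → Fin (2 * d) → (ratCharpoly A).SplittingField}
  (hu0 : ∀ μ, u μ ≠ 0)
  (hu : ∀ μ, intMulVec A.1 (u μ) = (μ : (ratCharpoly A).SplittingField) • u μ)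

theorem eigenbasis_vec (μ : splittingRoots (ratCharpoly A)) :
    (hA.eigenbasis hJ hAJ φ hu0 hu).vec μ = φ ∘ u μ :=
  by
  dsimp only [eigenbasis]
  rw [Module.Basis.mk_apply]

/-- The coefficients of `B` in the eigenbasis are detected by the symplectic form. -/
theorem eigenbasis_edge_iff (i j : splittingRoots (ratCharpoly A)) :
    (hA.eigenbasis hJ hAJ φ hu0 hu).Edge B i j ↔
      intForm J (u ((hA.eigenbasis hJ hAJ φ hu0 hu).inv i)) (intMulVec B.1 (u j)) ≠ 0 := by
  set E := hA.eigenbasis hJ hAJ φ hu0 hu with hE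
  have hvec : ∀ μ, E.vec μ = φ ∘ u μ := hA.eigenbasis_vec hJ hAJ φ hu0 hu
  have hexp : ∀ x, realForm J (E.vec (E.inv i)) x =
      E.vec.repr x i * realForm J (E.vec (E.inv i)) (E.vec i) := by
    intro x
    conv_lhs => rw [← E.vec.sum_repr x]
    rw [map_sum, Finset.sum_eq_single i]
    · rw [map_smul, smul_eq_mul]
    · intro p _ hp
      rw [map_smul, E.form_eq_zero _ _ (by rwa [E.inv_inv]), smul_zero]
    · simp
  have hne : realForm J (E.vec (E.inv i)) (E.vec i) ≠ 0 := by
    intro h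
    obtain ⟨y, hy⟩ := exists_intForm_ne_zero hJ (E.vec.ne_zero (E.inv i))
    rw [← realForm_apply, hexp, h, mul_zero] at hy
    exact hy rfl
  rw [SymplecticEigenbasis.Edge, ← mul_ne_zero_iff_right hne, ← hexp,
    realForm_apply, realRepresentation_apply, hvec, hvec, ← map_comp_intMulVec, ← map_intForm,
    _root_.map_ne_zero]

/-- The pattern of `B` is invariant under the Galois group. -/
theorem eigenbasis_edge_galois (τ : (ratCharpoly A).SplittingField →+*
    (ratCharpoly A).SplittingField) {i j i' j' : splittingRoots (ratCharpoly A)}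
    (hi : τ i = i') (hj : τ j = j') (h : (hA.eigenbasis hJ hAJ φ hu0 hu).Edge B i j) :
    (hA.eigenbasis hJ hAJ φ hu0 hu).Edge B i' j' := by
  rw [eigenbasis_edge_iff] at h
  set E := hA.eigenbasis hJ hAJ φ hu0 hu with hE
  have hvec : ∀ μ, E.vec μ = φ ∘ u μ := hA.eigenbasis_vec hJ hAJ φ hu0 hu
  -- Applying `τ` to the entries of an eigenvector for `p` gives one for `p'`; the spectrum is
  -- simple, so it is a multiple of the chosen one.
  have hmul : ∀ p p' : splittingRoots (ratCharpoly A), τ p = p' →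
      ∃ c : ℝ, (φ.comp τ) ∘ u p = c • E.vec p' := by
    intro p p' hp
    have h1 := intMulVec_comp_eigenvector (φ.comp τ) (hu p)
    rw [RingHom.comp_apply, hp] at h1
    set x := (φ.comp τ) ∘ u p
    refine ⟨E.vec.repr x p', ?_⟩
    conv_lhs => rw [← E.vec.sum_repr x]
    refine Finset.sum_eq_single p' (fun q _ hq => ?_) (by simp)
    have h2 : E.vec.repr (realRepresentation d A x) q = φ p' * E.vec.repr x q := by
      rw [realRepresentation_apply, h1]
      simp
    have h3 : E.vec.repr (realRepresentation d A x) q = φ q * E.vec.repr x q := by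
      conv_lhs => rw [← E.vec.sum_repr x]
      simp only [map_sum, map_smul, E.apply_vec, Finsupp.coe_finsetSum, Finset.sum_apply,
        Finsupp.smul_apply, smul_eq_mul, Module.Basis.repr_self]
      rw [Finset.sum_eq_single q]
      · simp only [Finsupp.single_eq_same, mul_one]
        exact mul_comm _ _
      · intro r _ hr
        simp [Finsupp.single_eq_of_ne hr.symm]
      · simp
    have h4 : (φ p' - φ q) * E.vec.repr x q = 0 := by linarith
    have h5 : φ p' - φ q ≠ 0 := fun h =>
      hq (Subtype.ext (φ.injective (sub_eq_zero.1 h).symm))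
    rw [(mul_eq_zero.1 h4).resolve_left h5, zero_smul]
  have hinv : τ (E.inv i) = E.inv i' := by
    change τ ((i : (ratCharpoly A).SplittingField)⁻¹) =
      ((i' : (ratCharpoly A).SplittingField)⁻¹)
    rw [map_inv₀, hi]
  obtain ⟨c, hc⟩ := hmul _ _ hinv
  obtain ⟨c', hc'⟩ := hmul _ _ hj
  rw [← _root_.map_ne_zero (φ.comp τ), map_intForm, map_comp_intMulVec, hc, hc',
    ← realRepresentation_apply, ← realForm_apply, map_smul, map_smul, map_smul,
    LinearMap.smul_apply, smul_eq_mul, smul_eq_mul, realForm_apply, realRepresentation_apply,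
    hvec, hvec, ← map_comp_intMulVec, ← map_intForm] at h
  rw [eigenbasis_edge_iff, ← _root_.map_ne_zero φ]
  exact right_ne_zero_of_mul (right_ne_zero_of_mul h)

end IsGaloisPinching

theorem theorem4p5 (d : ℕ) (J : Matrix (Fin (2 * d)) (Fin (2 * d)) ℤ)
    (hJ : IsIntSymplecticForm J)
    (A B : Matrix.SpecialLinearGroup (Fin (2 * d)) ℤ)
    (hA : A ∈ SpInt J) (hB : B ∈ SpInt J)
    (hpinch : IsGaloisPinching A)
    (hshare : ¬ ∃ F : Submodule ℝ (Fin (2 * d) → ℝ), F ≠ ⊥ ∧ F ≠ ⊤ ∧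
      F ∈ (realAction A).invtSubmodule ∧ F ∈ (realAction (B ^ 2)).invtSubmodule) :
    ∃ m : ℕ, 1 ≤ m ∧ ∀ L : ℤ, ∃ l : Fin (m - 1) → ℤ, (∀ i, L < l i) ∧
      ∀ k : ℕ, 1 ≤ k → k ≤ d → IsTwisting J k A (twistWord A B l) := by
  obtain ⟨φ⟩ := hpinch.nonempty_real_embedding
  choose u hu0 hu using hpinch.exists_eigenvector
  set E := hpinch.eigenbasis hJ.2 hA φ hu0 hu
  have hΩ : ∀ x, realForm J x x = 0 := fun x => by rw [realForm_apply, intForm_self hJ.1]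
  have hnd : ∀ x, x ≠ 0 → ∃ y, realForm J x y ≠ 0 := by
    intro x hx
    obtain ⟨y, hy⟩ := exists_intForm_ne_zero hJ.2 hx
    exact ⟨y, by rwa [realForm_apply]⟩
  have hpres : ∀ C ∈ SpInt J, ∀ x y,
      realForm J (realRepresentation d C x) (realRepresentation d C y) = realForm J x y := by
    intro C hC x y
    simp only [realForm_apply, realRepresentation_apply]
    exact intForm_intMulVec hC x y
  have hpow : realAction (B ^ 2) = realRepresentation d B ^ 2 :=
    map_pow (realRepresentation d) B 2
  rw [hpow] at hshare
  have h0 : (0 : (ratCharpoly A).SplittingField) ∉ splittingRoots (ratCharpoly A) := fun h =>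
    (hpinch.ne_zero_one_neg_one h).1 rfl
  have hinv : ∀ i j : splittingRoots (ratCharpoly A), j ≠ E.inv i →
      (j : (ratCharpoly A).SplittingField) ≠ (i : (ratCharpoly A).SplittingField)⁻¹ :=
    fun i j h h' => h (Subtype.ext h')
  obtain ⟨hlong, hshort⟩ := symmetric_pattern_connected E.inv E.inv_inv E.inv_ne (E.Edge B)
    (fun i j i' j' h1 h2 h3 h4 h => by
      obtain ⟨g, hg, hg'⟩ := hpinch.largest_galois.exists_algEquiv_apply_eq_pair h0 i.2 j.2
        i'.2 j'.2 (fun h => h1 (Subtype.ext h)) (hinv _ _ h2) (fun h => h3 (Subtype.ext h))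
        (hinv _ _ h4)
      exact hpinch.eigenbasis_edge_galois hJ.2 hA φ hu0 hu (g : _ →+* _) hg hg' h)
    (fun i j h => by
      obtain ⟨g, hg⟩ := hpinch.largest_galois.exists_algEquiv_apply_eq h0 i.2 j.2
      exact hpinch.eigenbasis_edge_galois hJ.2 hA φ hu0 hu (g : _ →+* _) hg hg h)
    (fun i j h => by
      obtain ⟨g, hg⟩ := hpinch.largest_galois.exists_algEquiv_apply_eq h0 i.2 j.2
      refine hpinch.eigenbasis_edge_galois hJ.2 hA φ hu0 hu (g : _ →+* _) hg ?_ h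
      change g ((i : (ratCharpoly A).SplittingField)⁻¹) =
        ((j : (ratCharpoly A).SplittingField)⁻¹)
      rw [map_inv₀, hg])
    (eq_empty_or_univ_of_irreducible E.vec E.apply_vec hshare)
  obtain ⟨n, hn⟩ := E.exists_transverse_twistWord
    (φ.injective.comp Subtype.val_injective) hΩ hnd (hpres A hA) (hpres B hB) hlong hshort
  -- The length counts the letters `B`: one per exponent and the final one.
  refine ⟨n + 1, Nat.le_add_left 1 n, fun L => ?_⟩
  obtain ⟨l, hl, hl'⟩ := hn L
  refine ⟨l, hl, fun k _ hk F hF F' hF' hAF hAF' => hl' F hAF F' hAF' ?_⟩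
  rw [hF.1, hF'.1, Module.finrank_fin_fun]
  omega
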